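/- Let $\mathfrak B$ be a Banach space over $\mathbb K\in\{\mathbb R,\mathbb C\}$, $[\mathfrak B]$ the space of bounded linear operators on $\mathfrak B$ with the operator norm, and let $A\in C(\mathbb R,[\mathfrak B])$, $f\in C(\mathbb R,\mathfrak B)$, $F\in C(\mathbb R\times\mathfrak B,\mathfrak B)$; these function spaces carry the compact-open topology. Let $U(t,A)$ be the Cauchy operator of $x'=A(t)x$, i.e. $U'=A(t)U$, $U(0,A)=\mathrm{Id}$. For a function $\psi$ of time (and possibly of a space variable) let $\psi^h$ be its time translate, $\psi^h(t)=\psi(t+h)$ (respectively $\psi^h(t,x)=\psi(t+h,x)$). Call $\psi$ Lagrange stable if $\{\psi^h: h\in\mathbb R\}$ is precompact. Let $\mathfrak L_\psi$ be the set of all real sequences $(t_n)$ with $t_n\to+\infty$ or $t_n\to-\infty$ for which $(\psi^{t_n})$ converges. For continuous $H:\mathbb R\times\mathfrak B\to\mathfrak B$ a solution $\varphi$ on $\mathbb R$ of $x'=A(t)x+f(t)+H(t,x)$ is called remotely compatible if $Q:=\overline{\varphi(\mathbb R)}$ is compact and $\mathfrak L_A\cap\mathfrak L_f\cap\mathfrak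 L_{H_Q}\subseteq\mathfrak L_\varphi$, where $H_Q:=H|_{\mathbb R\times Q}$. Assume: 1. $x'=A(t)x$ is hyperbolic on $\mathbb R$: there are a projection $P\in[\mathfrak B]$ and constants $\mathcal N\ge1$, $\nu>0$ such that $\|U(t,A)PU^{-1}(\tau,A)\|\le\mathcal N e^{-\nu(t-\tau)}$ for $t>\tau$ and $\|U(t,A)(\mathrm{Id}-P)U^{-1}(\tau,A)\|\le\mathcal N e^{\nu(t-\tau)}$ for $t<\tau$; 2. (Condition (C)) $\{U(t,A)PU^{-1}(t,A): t\in\mathbb R\}$ is a precompact subset of $[\mathfrak B]$; 3. $A$, $f$ and $F$ are Lagrange stable; 4. $|F(t,x)-F(t,y)|\le L|x-y|$ for all $t\in\mathbb R$ and $x,y\in\mathfrak B$, with a constant $L>0$. Let $G_A(t,\tau)=U(t,A)PU^{-1}(\tau,A)$ for $t>\tau$ and $G_A(t,\tau)=-U(t,A)(\mathrm{Id}-P)U^{-1}(\tau,A)$ for $t<\tau$. Then there are $\varepsilon_0>0$ and bounded continuous functions $\varphi_\varepsilon:\mathbb R\to\mathfrak B$ ($\varepsilon\in\mathbb K$, $|\varepsilon|\le\varepsilon_0$)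 such that: (i) for every $|\varepsilon|\le\varepsilon_0$, $\varphi_\varepsilon$ is a remotely compatible solution of $$x'=A(t)x+f(t)+\varepsilon F(t,x);$$ (ii) for every $|\varepsilon|\le\varepsilon_0$ and $t\in\mathbb R$, $$\varphi_\varepsilon(t)=\int_{-\infty}^{+\infty}G_A(t,\tau)\,[f(\tau)+\varepsilon F(\tau,\varphi_\varepsilon(\tau))]\,d\tau,$$ the integral converging absolutely; (iii) $\varphi_\varepsilon\to\varphi_0$ uniformly on $\mathbb R$ as $\varepsilon\to0$, where $\varphi_0$ is the remotely compatible solution $\varphi_0(t)=\int_{-\infty}^{+\infty}G_A(t,\tau)f(\tau)\,d\tau$ of $x'=A(t)x+f(t)$. -/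

import Mathlib

open Filter Topology MeasureTheory Set
open scoped BoundedContinuousFunction

/-! ### The Cauchy operator of a linear equation -/

/-- The terms of the Peano--Baker series of `u' = a(t) u`, `u(0) = 1`. -/
noncomputable def peanoBakerTerm {R : Type*} [NormedRing R] [NormedSpace ℝ R]
    (a : ℝ → R) : ℕ → ℝ → R
  | 0 => fun _ => 1
  | n + 1 => fun t => ∫ s in (0 : ℝ)..t, a s * peanoBakerTerm a n s

theorem continuous_peanoBakerTerm {R : Type*} [NormedRing R] [NormedSpace ℝ R] [CompleteSpace R]
    {a : ℝ → R} (ha : Continuous a) (n : ℕ) : Continuous (peanoBakerTerm a n) := by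
  induction n with
  | zero => exact continuous_const
  | succ n ih =>
    have h : Continuous fun s => a s * peanoBakerTerm a n s := ha.mul ih
    exact intervalIntegral.continuous_primitive (fun _ _ => h.intervalIntegrable _ _) 0

theorem hasDerivAt_peanoBakerTerm_succ {R : Type*} [NormedRing R] [NormedSpace ℝ R]
    [CompleteSpace R] {a : ℝ → R} (ha : Continuous a) (n : ℕ) (t : ℝ) :
    HasDerivAt (peanoBakerTerm a (n + 1)) (a t * peanoBakerTerm a n t) t := by
  have h : Continuous fun s => a s * peanoBakerTerm a n s :=
    ha.mul (continuous_peanoBakerTerm ha n)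
  exact intervalIntegral.integral_hasDerivAt_right (h.intervalIntegrable _ _)
    h.aestronglyMeasurable.stronglyMeasurableAtFilter h.continuousAt

theorem norm_peanoBakerTerm_le {R : Type*} [NormedRing R] [NormedSpace ℝ R] [CompleteSpace R]
    {a : ℝ → R} (ha : Continuous a) {T M : ℝ} (hM : 0 ≤ M) (hb : ∀ s, |s| ≤ T → ‖a s‖ ≤ M)
    (n : ℕ) : ∀ t, |t| ≤ T →
      ‖peanoBakerTerm a n t‖ ≤ ‖(1 : R)‖ * M ^ n * (|t| ^ n / (n.factorial : ℝ)) := by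
  induction n with
  | zero => intro t _; simp [peanoBakerTerm]
  | succ n ih =>
    intro t ht
    have hc : Continuous fun s => a s * peanoBakerTerm a n s :=
      ha.mul (continuous_peanoBakerTerm ha n)
    have hc2 : Continuous fun s : ℝ =>
        ‖(1 : R)‖ * M ^ (n + 1) / (n.factorial : ℝ) * |s - 0| ^ n := by fun_prop
    calc ‖peanoBakerTerm a (n + 1) t‖
        ≤ ∫ s in uIoc 0 t, ‖a s * peanoBakerTerm a n s‖ :=
          intervalIntegral.norm_integral_le_integral_norm_uIoc
      _ ≤ ∫ s in uIoc 0 t, ‖(1 : R)‖ * M ^ (n + 1) / (n.factorial : ℝ) * |s - 0| ^ n := by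
          refine setIntegral_mono_on ?_ ?_ measurableSet_uIoc ?_
          · exact (intervalIntegrable_iff.1 (hc.norm.intervalIntegrable 0 t))
          · exact (intervalIntegrable_iff.1 (hc2.intervalIntegrable 0 t))
          · intro s hs
            have hs' : |s| ≤ T := by
              have := abs_sub_left_of_mem_uIcc (uIoc_subset_uIcc hs)
              simp only [sub_zero] at this
              exact this.trans ht
            refine (norm_mul_le _ _).trans ?_
            refine (mul_le_mul (hb s hs') (ih s hs') (norm_nonneg _) hM).trans (le_of_eq ?_)
            rw [sub_zero]; ring
      _ = ‖(1 : R)‖ * M ^ (n + 1) * (|t| ^ (n + 1) / ((n + 1).factorial : ℝ)) := by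
          rw [integral_const_mul, integral_pow_abs_sub_uIoc, sub_zero, Nat.factorial_succ]
          push_cast
          field_simp

/-- A linear equation with continuous coefficients has a global fundamental solution. -/
theorem exists_fundamental_solution {R : Type*} [NormedRing R] [NormedSpace ℝ R]
    [CompleteSpace R] {a : ℝ → R} (ha : Continuous a) :
    ∃ u : ℝ → R, u 0 = 1 ∧ ∀ t, HasDerivAt u (a t * u t) t := by
  have h0 : ∀ n, peanoBakerTerm a (n + 1) 0 = 0 := fun n => by simp [peanoBakerTerm]
  refine ⟨fun t => 1 + ∑' n, peanoBakerTerm a (n + 1) t, by simp [h0], fun t => ?_⟩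
  obtain ⟨T, hT⟩ : ∃ T, |t| < T := exists_gt _
  obtain ⟨M, hM⟩ := (isCompact_Icc (a := -T) (b := T)).exists_bound_of_continuousOn
    ha.continuousOn
  have hT0 : 0 < T := (abs_nonneg t).trans_lt hT
  have hM0 : 0 ≤ M := (norm_nonneg _).trans (hM 0 ⟨by linarith, hT0.le⟩)
  have hb : ∀ s, |s| ≤ T → ‖a s‖ ≤ M := fun s hs => hM s (abs_le.1 hs)
  have hbd : ∀ n s, |s| ≤ T →
      ‖peanoBakerTerm a n s‖ ≤ ‖(1 : R)‖ * ((M * T) ^ n / (n.factorial : ℝ)) := by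
    intro n s hs
    refine (norm_peanoBakerTerm_le ha hM0 hb n s hs).trans ?_
    have : |s| ^ n ≤ T ^ n := pow_le_pow_left₀ (abs_nonneg s) hs n
    calc ‖(1 : R)‖ * M ^ n * (|s| ^ n / (n.factorial : ℝ))
        ≤ ‖(1 : R)‖ * M ^ n * (T ^ n / (n.factorial : ℝ)) := by gcongr
      _ = _ := by rw [mul_pow]; ring
  have hsum : Summable fun n : ℕ => ‖(1 : R)‖ * ((M * T) ^ n / (n.factorial : ℝ)) :=
    (Real.summable_pow_div_factorial (M * T)).mul_left _
  have hsR : Summable fun n => peanoBakerTerm a n t :=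
    .of_norm_bounded hsum fun n => hbd n t hT.le
  have hder := hasDerivAt_tsum_of_isPreconnected (𝕜 := ℝ) (t := Ioo (-T) T)
    (g := fun n => peanoBakerTerm a (n + 1)) (g' := fun n s => a s * peanoBakerTerm a n s)
    (u := fun n : ℕ => M * (‖(1 : R)‖ * ((M * T) ^ n / (n.factorial : ℝ)))) (y₀ := 0) (y := t)
    (hsum.mul_left M) isOpen_Ioo isPreconnected_Ioo
    (fun n s _ => hasDerivAt_peanoBakerTerm_succ ha n s)
    (fun n s hs => (norm_mul_le _ _).trans
      (mul_le_mul (hb s (abs_le.2 ⟨hs.1.le, hs.2.le⟩)) (hbd n s (abs_le.2 ⟨hs.1.le, hs.2.le⟩))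
        (norm_nonneg _) hM0))
    ⟨by linarith, hT0⟩ (by simp [h0]) (abs_lt.1 hT)
  have hval : ∑' n, a t * peanoBakerTerm a n t
      = a t * (1 + ∑' n, peanoBakerTerm a (n + 1) t) := by
    rw [hsR.tsum_mul_left, hsR.tsum_eq_zero_add]; rfl
  rw [hval] at hder
  exact hder.const_add 1

/-- The Cauchy operator `U(·, A)` of `x' = A(t) x`: the operator-valued solution with value the
identity at time `0`. -/
noncomputable def cauchyOperator {𝕜 E : Type*} [RCLike 𝕜] [NormedAddCommGroup E] [NormedSpace ℝ E]
    [NormedSpace 𝕜 E] [IsScalarTower ℝ 𝕜 E] [CompleteSpace E] (A : C(ℝ, E →L[𝕜] E)) :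
    ℝ → (E →L[𝕜] E) :=
  Classical.choose (exists_fundamental_solution A.continuous)

theorem cauchyOperator_zero {𝕜 E : Type*} [RCLike 𝕜] [NormedAddCommGroup E] [NormedSpace ℝ E]
    [NormedSpace 𝕜 E] [IsScalarTower ℝ 𝕜 E] [CompleteSpace E] (A : C(ℝ, E →L[𝕜] E)) :
    cauchyOperator A 0 = 1 :=
  (Classical.choose_spec (exists_fundamental_solution A.continuous)).1

theorem hasDerivAt_cauchyOperator {𝕜 E : Type*} [RCLike 𝕜] [NormedAddCommGroup E]
    [NormedSpace ℝ E] [NormedSpace 𝕜 E] [IsScalarTower ℝ 𝕜 E] [CompleteSpace E]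
    (A : C(ℝ, E →L[𝕜] E)) (t : ℝ) :
    HasDerivAt (cauchyOperator A) (A t * cauchyOperator A t) t :=
  (Classical.choose_spec (exists_fundamental_solution A.continuous)).2 t

/-- The operator `U(t, A) S U⁻¹(τ, A)`. -/
noncomputable def conjCauchy {𝕜 E : Type*} [RCLike 𝕜] [NormedAddCommGroup E] [NormedSpace ℝ E]
    [NormedSpace 𝕜 E] [IsScalarTower ℝ 𝕜 E] [CompleteSpace E] (A : C(ℝ, E →L[𝕜] E))
    (S : E →L[𝕜] E) (t τ : ℝ) : E →L[𝕜] E :=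
  cauchyOperator A t * S * Ring.inverse (cauchyOperator A τ)

/-! ### Exponential dichotomy, Condition (C), Green's function -/

/-- The equation `x' = A(t) x` has an exponential dichotomy on `I` with the projection `P`. -/
def HasExpDichotomy {𝕜 E : Type*} [RCLike 𝕜] [NormedAddCommGroup E] [NormedSpace ℝ E]
    [NormedSpace 𝕜 E] [IsScalarTower ℝ 𝕜 E] [CompleteSpace E] (A : C(ℝ, E →L[𝕜] E))
    (I : Set ℝ) (P : E →L[𝕜] E) : Prop :=
  IsIdempotentElem P ∧ ∃ N ν : ℝ, 1 ≤ N ∧ 0 < ν ∧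
    (∀ t ∈ I, ∀ τ ∈ I, τ < t → ‖conjCauchy A P t τ‖ ≤ N * Real.exp (-ν * (t - τ))) ∧
    (∀ t ∈ I, ∀ τ ∈ I, t < τ → ‖conjCauchy A (1 - P) t τ‖ ≤ N * Real.exp (ν * (t - τ)))

/-- Condition (C): the projections `P(t) = U(t, A) P U⁻¹(t, A)`, `t ∈ ℝ`, form a precompact set
in the operator norm. -/
def ConditionC {𝕜 E : Type*} [RCLike 𝕜] [NormedAddCommGroup E] [NormedSpace ℝ E]
    [NormedSpace 𝕜 E] [IsScalarTower ℝ 𝕜 E] [CompleteSpace E] (A : C(ℝ, E →L[𝕜] E))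
    (P : E →L[𝕜] E) : Prop :=
  IsCompact (closure (range fun t : ℝ => conjCauchy A P t t))

open Classical in
/-- Green's function; the value on the diagonal `t = τ` plays no role. -/
noncomputable def greenFunction {𝕜 E : Type*} [RCLike 𝕜] [NormedAddCommGroup E] [NormedSpace ℝ E]
    [NormedSpace 𝕜 E] [IsScalarTower ℝ 𝕜 E] [CompleteSpace E] (A : C(ℝ, E →L[𝕜] E))
    (P : E →L[𝕜] E) (t τ : ℝ) : E →L[𝕜] E :=
  if τ < t then conjCauchy A P t τ else -conjCauchy A (1 - P) t τ

/-- `φ(t) = ∫ G_A(t, τ) g(τ) dτ` for every `t`, the integral over `ℝ` being absolutely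
convergent. -/
def IsGreenIntegral {𝕜 E : Type*} [RCLike 𝕜] [NormedAddCommGroup E] [NormedSpace ℝ E]
    [NormedSpace 𝕜 E] [IsScalarTower ℝ 𝕜 E] [CompleteSpace E] (A : C(ℝ, E →L[𝕜] E))
    (P : E →L[𝕜] E) (g φ : ℝ → E) : Prop :=
  ∀ t, Integrable (fun τ => greenFunction A P t τ (g τ)) ∧
    φ t = ∫ τ, greenFunction A P t τ (g τ)

/-! ### Shift dynamical systems

The spaces `C(ℝ, Y)` and `C(ℝ × X, Y)` carry the compact-open topology. -/

/-- The translate `φ^h(t) = φ(t + h)`. -/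
def timeShift {Y : Type*} [TopologicalSpace Y] (h : ℝ) (φ : C(ℝ, Y)) : C(ℝ, Y) :=
  ⟨fun t => φ (t + h), by fun_prop⟩

/-- The translate `F^h(t, x) = F(t + h, x)`. -/
def timeShift₂ {X Y : Type*} [TopologicalSpace X] [TopologicalSpace Y] (h : ℝ)
    (F : C(ℝ × X, Y)) : C(ℝ × X, Y) :=
  ⟨fun p => F (p.1 + h, p.2), by fun_prop⟩

/-- Lagrange stability: the set of all translates is precompact. -/
def LagrangeStable {Y : Type*} [TopologicalSpace Y] (φ : C(ℝ, Y)) : Prop :=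
  IsCompact (closure (range fun h : ℝ => timeShift h φ))

def LagrangeStable₂ {X Y : Type*} [TopologicalSpace X] [TopologicalSpace Y]
    (F : C(ℝ × X, Y)) : Prop :=
  IsCompact (closure (range fun h : ℝ => timeShift₂ h F))

/-- `t_n → +∞` or `t_n → -∞`. -/
def TendsToInfinity (t : ℕ → ℝ) : Prop :=
  Tendsto t atTop atTop ∨ Tendsto t atTop atBot

/-- The set `𝔏_φ` of all sequences `t_n → +∞` or `t_n → -∞` along which the translates of `φ`
converge. -/
def limitSeqs {Y : Type*} [TopologicalSpace Y] (φ : C(ℝ, Y)) : Set (ℕ → ℝ) :=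
  {t | TendsToInfinity t ∧ ∃ ψ, Tendsto (fun n => timeShift (t n) φ) atTop (𝓝 ψ)}

def limitSeqs₂ {X Y : Type*} [TopologicalSpace X] [TopologicalSpace Y] (F : C(ℝ × X, Y)) :
    Set (ℕ → ℝ) :=
  {t | TendsToInfinity t ∧ ∃ G, Tendsto (fun n => timeShift₂ (t n) F) atTop (𝓝 G)}

/-- The restriction `F_Q` of `F` to `ℝ × Q`. -/
def restrictSpace {X Y : Type*} [TopologicalSpace X] [TopologicalSpace Y] (F : C(ℝ × X, Y))
    (Q : Set X) : C(ℝ × Q, Y) :=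
  ⟨fun p => F (p.1, (p.2 : X)), by fun_prop⟩

/-! ### Remotely compatible solutions -/

/-- `φ` is a solution on `ℝ` of `x' = A(t) x + f(t) + H(t, x)`. -/
def IsSolutionOnLine {𝕜 E : Type*} [RCLike 𝕜] [NormedAddCommGroup E] [NormedSpace ℝ E]
    [NormedSpace 𝕜 E] (A : C(ℝ, E →L[𝕜] E)) (f : C(ℝ, E)) (H : C(ℝ × E, E))
    (φ : C(ℝ, E)) : Prop :=
  ∀ t, HasDerivAt φ (A t (φ t) + f t + H (t, φ t)) t

/-- A remotely compatible solution: a solution on `ℝ` such that `Q`, the closure of its range, is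
compact, and along every sequence `t_n → ±∞` for which the translates of `A`, `f` and `H_Q` all
converge, the translates of the solution converge too. -/
def IsRemotelyCompatibleSolution {𝕜 E : Type*} [RCLike 𝕜] [NormedAddCommGroup E]
    [NormedSpace ℝ E] [NormedSpace 𝕜 E] (A : C(ℝ, E →L[𝕜] E)) (f : C(ℝ, E)) (H : C(ℝ × E, E))
    (φ : C(ℝ, E)) : Prop :=
  IsSolutionOnLine A f H φ ∧ IsCompact (closure (range φ)) ∧
    limitSeqs A ∩ limitSeqs f ∩ limitSeqs₂ (restrictSpace H (closure (range φ))) ⊆ limitSeqs φ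

/-! A solution of the perturbed equation is a fixed point of the Green operator sending `ψ` to the
Green integral of `f + ε F(·, ψ)`. Its kernel is dominated by `N e^{-ν|t-τ|}`, of mass `c`, so in
the sup norm it has Lipschitz constant `c ‖ε‖ L`. Taking `ε` small makes this at most `1/2`.
Banach's theorem gives `φ ε`, and the same estimate gives `‖φ ε - φ 0‖ = O(‖ε‖)`
(`dist_le_of_eq_greenIntegral`).

The rest depends on how Green's function behaves under translation. Shifting time by `h` replaces
`A` by its translate and `P` by `U(h) P U⁻¹(h)` (`greenFunction_add`). If the translates of `A`
along `t n` converge, every cluster point of these projections is a dichotomy projection of the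
limit equation with the same constants. Such a projection is unique (`projection_unique`), so
Condition (C) forces convergence (`exists_tendsto_projection`), and Green's functions converge
pointwise.

Compactness of the range: the Green operator preserves the property that translates have pointwise
convergent subsequences (`ShiftPrecompact.greenIntegral`). The Picard iterates from `0` therefore
have totally bounded ranges, and so does their uniform limit.

Remote compatibility: the asymptotic oscillation of `φ (s + t n)` in `n` is at most half of any
bound for it valid at all `s`. Iterating from `2 ‖φ‖` shows that it vanishes
(`cauchySeq_of_eq_greenIntegral`). Since `φ` is Lipschitz, pointwise convergence of its translates
is locally uniform. -/

/-! ### Linear equations: uniqueness, the cocycle identity, continuous dependence on the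
coefficient. -/

section LinearODE

theorem norm_le_gronwallBound_of_hasDerivAt {X : Type*} [NormedAddCommGroup X] [NormedSpace ℝ X]
    {u u' : ℝ → X} {δ K η T : ℝ} (hu : ∀ t, HasDerivAt u (u' t) t) (h0 : ‖u 0‖ ≤ δ)
    (hb : ∀ t, |t| ≤ T → ‖u' t‖ ≤ K * ‖u t‖ + η) {t : ℝ} (ht : |t| ≤ T) :
    ‖u t‖ ≤ gronwallBound δ K η |t| := by
  rcases le_total 0 t with h | h
  · rw [abs_of_nonneg h] at ht ⊢
    have := norm_le_gronwallBound_of_norm_deriv_right_le (f := u) (f' := u') (δ := δ) (K := K)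
      (ε := η) (a := 0) (b := t) (fun s _ => (hu s).continuousAt.continuousWithinAt)
      (fun s _ => (hu s).hasDerivWithinAt) h0
      (fun s hs => hb s (by rw [abs_of_nonneg hs.1]; linarith [hs.2])) t ⟨h, le_rfl⟩
    simpa using this
  · rw [abs_of_nonpos h] at ht ⊢
    have hv : ∀ s, HasDerivAt (fun s => u (-s)) (-u' (-s)) s := fun s => by
      simpa [Function.comp_def] using (hu (-s)).scomp s (hasDerivAt_neg s)
    have := norm_le_gronwallBound_of_norm_deriv_right_le (f := fun s => u (-s))
      (f' := fun s => -u' (-s)) (δ := δ) (K := K)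
      (ε := η) (a := 0) (b := -t) (fun s _ => (hv s).continuousAt.continuousWithinAt)
      (fun s _ => (hv s).hasDerivWithinAt) (by simpa using h0)
      (fun s hs => by
        rw [norm_neg]
        exact hb (-s) (by rw [abs_neg, abs_of_nonneg hs.1]; linarith [hs.2])) (-t)
      ⟨by linarith, le_rfl⟩
    simpa using this

variable {𝕜 E : Type*} [RCLike 𝕜] [NormedAddCommGroup E] [NormedSpace ℝ E]
  [NormedSpace 𝕜 E] [IsScalarTower ℝ 𝕜 E]

theorem HasDerivAt.mul_right_const {U : ℝ → E →L[𝕜] E} {U' : E →L[𝕜] E} {t : ℝ}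
    (hU : HasDerivAt U U' t) (S : E →L[𝕜] E) : HasDerivAt (fun t => U t * S) (U' * S) t :=
  (((ContinuousLinearMap.compL 𝕜 E E E).flip S).restrictScalars ℝ).hasFDerivAt.comp_hasDerivAt
    t hU

theorem HasDerivAt.clm_apply_real {U : ℝ → E →L[𝕜] E} {U' : E →L[𝕜] E} {y : ℝ → E} {y' : E}
    {t : ℝ} (hU : HasDerivAt U U' t) (hy : HasDerivAt y y' t) :
    HasDerivAt (fun t => U t (y t)) (U' (y t) + U t y') t :=
  HasDerivAt.clm_apply (𝕜 := ℝ) (c := fun t => (U t).restrictScalars ℝ)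
    ((ContinuousLinearMap.restrictScalarsL 𝕜 E E ℝ ℝ).hasFDerivAt.comp_hasDerivAt t hU) hy

variable [CompleteSpace E]

theorem eq_zero_of_hasDerivAt_mul {R : Type*} [NormedRing R] [NormedSpace ℝ R]
    {a u : ℝ → R} (ha : Continuous a) (hu : ∀ t, HasDerivAt u (a t * u t) t) (h0 : u 0 = 0)
    (t : ℝ) : u t = 0 := by
  obtain ⟨M, hM⟩ := (isCompact_Icc (a := -|t|) (b := |t|)).exists_bound_of_continuousOn
    ha.continuousOn
  have h := norm_le_gronwallBound_of_hasDerivAt (δ := 0) (K := M) (η := 0) (T := |t|) hu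
    (by simp [h0]) (fun s hs => by
      rw [add_zero]
      exact (norm_mul_le _ _).trans
        (mul_le_mul_of_nonneg_right (hM s (abs_le.1 hs)) (norm_nonneg _))) le_rfl
  rw [gronwallBound_ε0_δ0] at h
  exact norm_le_zero_iff.1 h

/-- Uniqueness for the operator equation, by Gronwall. `cauchyOperator` is obtained by choice, so
all its algebraic properties come from here. -/
theorem eq_cauchyOperator_mul (A : C(ℝ, E →L[𝕜] E)) {V : ℝ → E →L[𝕜] E}
    (hV : ∀ t, HasDerivAt V (A t * V t) t) (t : ℝ) : V t = cauchyOperator A t * V 0 := by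
  have h := eq_zero_of_hasDerivAt_mul (u := fun t => V t - cauchyOperator A t * V 0) A.continuous
    (fun s => by
      have := (hV s).sub ((hasDerivAt_cauchyOperator A s).mul_right_const (V 0))
      rwa [mul_assoc, ← mul_sub] at this) (by simp [cauchyOperator_zero]) t
  exact sub_eq_zero.1 h

theorem cauchyOperator_add (A : C(ℝ, E →L[𝕜] E)) (t h : ℝ) :
    cauchyOperator A (t + h) = cauchyOperator (timeShift h A) t * cauchyOperator A h := by
  have := eq_cauchyOperator_mul (timeShift h A) (V := fun t => cauchyOperator A (t + h))
    (fun s => (hasDerivAt_cauchyOperator A (s + h)).comp_add_const s h) t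
  simpa using this

theorem timeShift_timeShift {Y : Type*} [TopologicalSpace Y] (h k : ℝ) (φ : C(ℝ, Y)) :
    timeShift h (timeShift k φ) = timeShift (h + k) φ := by
  ext t; simp [timeShift, add_assoc]

theorem timeShift_zero {Y : Type*} [TopologicalSpace Y] (φ : C(ℝ, Y)) : timeShift 0 φ = φ := by
  ext t; simp [timeShift]

@[simp] theorem timeShift_apply {Y : Type*} [TopologicalSpace Y] (h : ℝ) (φ : C(ℝ, Y)) (t : ℝ) :
    timeShift h φ t = φ (t + h) := rfl

theorem isUnit_cauchyOperator (A : C(ℝ, E →L[𝕜] E)) (t : ℝ) : IsUnit (cauchyOperator A t) := by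
  have h1 := cauchyOperator_add A (-t) t
  have h2 := cauchyOperator_add (timeShift t A) t (-t)
  rw [timeShift_timeShift, neg_add_cancel, timeShift_zero, add_neg_cancel,
    cauchyOperator_zero] at h2
  rw [neg_add_cancel, cauchyOperator_zero] at h1
  -- The cocycle identity at `(t, -t)` and at `(-t, t)` supplies the two sides of the inverse.
  exact ⟨⟨_, _, h2.symm, h1.symm⟩, rfl⟩

theorem continuous_cauchyOperator (A : C(ℝ, E →L[𝕜] E)) : Continuous (cauchyOperator A) :=
  continuous_iff_continuousAt.2 fun t => (hasDerivAt_cauchyOperator A t).continuousAt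

theorem continuous_inverse_cauchyOperator (A : C(ℝ, E →L[𝕜] E)) :
    Continuous fun t => Ring.inverse (cauchyOperator A t) := by
  refine continuous_iff_continuousAt.2 fun t => ?_
  obtain ⟨v, hv⟩ := isUnit_cauchyOperator A t
  have := NormedRing.inverse_continuousAt v
  rw [hv] at this
  exact this.comp (continuous_cauchyOperator A).continuousAt

theorem inverse_mul_cauchyOperator (A : C(ℝ, E →L[𝕜] E)) (t : ℝ) :
    Ring.inverse (cauchyOperator A t) * cauchyOperator A t = 1 :=
  Ring.inverse_mul_cancel _ (isUnit_cauchyOperator A t)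

theorem cauchyOperator_mul_inverse (A : C(ℝ, E →L[𝕜] E)) (t : ℝ) :
    cauchyOperator A t * Ring.inverse (cauchyOperator A t) = 1 :=
  Ring.mul_inverse_cancel _ (isUnit_cauchyOperator A t)

theorem conjCauchy_add (A : C(ℝ, E →L[𝕜] E)) (S : E →L[𝕜] E) (t τ h : ℝ) :
    conjCauchy A S (t + h) (τ + h) = conjCauchy (timeShift h A) (conjCauchy A S h h) t τ := by
  have hinv : Ring.inverse (cauchyOperator A (τ + h)) =
      Ring.inverse (cauchyOperator A h) * Ring.inverse (cauchyOperator (timeShift h A) τ) := by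
    obtain ⟨u, hu⟩ := isUnit_cauchyOperator A h
    obtain ⟨v, hv⟩ := isUnit_cauchyOperator (timeShift h A) τ
    rw [cauchyOperator_add, ← hu, ← hv, ← Units.val_mul, Ring.inverse_unit, Ring.inverse_unit,
      Ring.inverse_unit, mul_inv_rev, Units.val_mul]
  simp only [conjCauchy, hinv, cauchyOperator_add A t h, mul_assoc]

theorem conjCauchy_one_sub_self (A : C(ℝ, E →L[𝕜] E)) (S : E →L[𝕜] E) (t : ℝ) :
    conjCauchy A (1 - S) t t = 1 - conjCauchy A S t t := by
  simp only [conjCauchy, mul_sub, sub_mul, mul_one, cauchyOperator_mul_inverse]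

theorem greenFunction_add (A : C(ℝ, E →L[𝕜] E)) (P : E →L[𝕜] E) (t τ h : ℝ) :
    greenFunction A P (t + h) (τ + h) =
      greenFunction (timeShift h A) (conjCauchy A P h h) t τ := by
  simp only [greenFunction, add_lt_add_iff_right, conjCauchy_add, conjCauchy_one_sub_self]

/-- The difference `D` of the two Cauchy operators satisfies `D' = a D + (a - b) U(·, b)` with `D 0
= 0`. Gronwall applies with the common rate `M`, and the forcing is uniformly small on `[-|t|,
|t|]`. -/
theorem tendsto_cauchyOperator {ι : Type*} {l : Filter ι} {a : ι → C(ℝ, E →L[𝕜] E)}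
    {b : C(ℝ, E →L[𝕜] E)} (h : Tendsto a l (𝓝 b)) {M : ℝ} (hM : ∀ i s, ‖a i s‖ ≤ M) (t : ℝ) :
    Tendsto (fun i => cauchyOperator (a i) t) l (𝓝 (cauchyOperator b t)) := by
  obtain ⟨C, hC⟩ := (isCompact_Icc (a := -|t|) (b := |t|)).exists_bound_of_continuousOn
    (continuous_cauchyOperator b).continuousOn
  have hg : Tendsto (fun η : ℝ => gronwallBound 0 M (η * C) |t|) (𝓝[>] 0) (𝓝 0) := by
    have := ((gronwallBound_continuous_ε 0 M |t|).comp (continuous_mul_const C)).tendsto 0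
    simp only [Function.comp_def, zero_mul, gronwallBound_ε0_δ0] at this
    exact this.mono_left nhdsWithin_le_nhds
  rw [Metric.tendsto_nhds]
  intro e he
  obtain ⟨η, hη, hη0⟩ := ((hg.eventually (gt_mem_nhds he)).and self_mem_nhdsWithin).exists
  have hunif := Metric.tendstoUniformlyOn_iff.1
    (ContinuousMap.tendsto_iff_forall_isCompact_tendstoUniformlyOn.1 h _
      (isCompact_Icc (a := -|t|) (b := |t|))) η hη0
  filter_upwards [hunif] with i hi
  rw [dist_eq_norm]
  refine lt_of_le_of_lt ?_ hη
  refine norm_le_gronwallBound_of_hasDerivAt (δ := 0) (T := |t|)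
    (u := fun s => cauchyOperator (a i) s - cauchyOperator b s)
    (fun s => (hasDerivAt_cauchyOperator (a i) s).sub (hasDerivAt_cauchyOperator b s))
    (by simp [cauchyOperator_zero]) (fun s hs => ?_) le_rfl
  have hs' := abs_le.1 hs
  have e1 : a i s * cauchyOperator (a i) s - b s * cauchyOperator b s
      = a i s * (cauchyOperator (a i) s - cauchyOperator b s)
        + (a i s - b s) * cauchyOperator b s := by
    rw [mul_sub, sub_mul]; abel
  rw [e1]
  refine (norm_add_le _ _).trans (add_le_add ?_ ?_)
  · exact (norm_mul_le _ _).trans (mul_le_mul_of_nonneg_right (hM i s) (norm_nonneg _))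
  · refine (norm_mul_le _ _).trans (mul_le_mul ?_ (hC s hs') (norm_nonneg _) (le_of_lt hη0))
    have := hi s hs'
    rw [dist_comm, dist_eq_norm] at this
    exact this.le

theorem tendsto_conjCauchy {ι : Type*} {l : Filter ι} {a : ι → C(ℝ, E →L[𝕜] E)}
    {b : C(ℝ, E →L[𝕜] E)} (h : Tendsto a l (𝓝 b)) {M : ℝ} (hM : ∀ i s, ‖a i s‖ ≤ M)
    {S : ι → E →L[𝕜] E} {S' : E →L[𝕜] E} (hS : Tendsto S l (𝓝 S')) (t τ : ℝ) :
    Tendsto (fun i => conjCauchy (a i) (S i) t τ) l (𝓝 (conjCauchy b S' t τ)) := by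
  refine ((tendsto_cauchyOperator h hM t).mul hS).mul ?_
  obtain ⟨v, hv⟩ := isUnit_cauchyOperator b τ
  have := NormedRing.inverse_continuousAt v
  rw [hv] at this
  exact this.tendsto.comp (tendsto_cauchyOperator h hM τ)

theorem tendsto_greenFunction {ι : Type*} {l : Filter ι} {a : ι → C(ℝ, E →L[𝕜] E)}
    {b : C(ℝ, E →L[𝕜] E)} (h : Tendsto a l (𝓝 b)) {M : ℝ} (hM : ∀ i s, ‖a i s‖ ≤ M)
    {S : ι → E →L[𝕜] E} {S' : E →L[𝕜] E} (hS : Tendsto S l (𝓝 S')) (t τ : ℝ) :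
    Tendsto (fun i => greenFunction (a i) (S i) t τ) l (𝓝 (greenFunction b S' t τ)) := by
  simp only [greenFunction]
  split_ifs
  · exact tendsto_conjCauchy h hM hS t τ
  · exact (tendsto_conjCauchy h hM (hS.const_sub 1) t τ).neg

end LinearODE

/-! ### Exponential dichotomies: limits and uniqueness of the projection. -/

section Dichotomy

variable {𝕜 E : Type*} [RCLike 𝕜] [NormedAddCommGroup E] [NormedSpace ℝ E]
  [NormedSpace 𝕜 E] [IsScalarTower ℝ 𝕜 E] [CompleteSpace E]

/-- An exponential dichotomy on the whole line with the constants `N` and `ν`. -/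
structure DichotomyWith (A : C(ℝ, E →L[𝕜] E)) (P : E →L[𝕜] E) (N ν : ℝ) : Prop where
  idem : IsIdempotentElem P
  stable : ∀ t τ, τ < t → ‖conjCauchy A P t τ‖ ≤ N * Real.exp (-ν * (t - τ))
  unstable : ∀ t τ, t < τ → ‖conjCauchy A (1 - P) t τ‖ ≤ N * Real.exp (ν * (t - τ))

namespace DichotomyWith

variable {A : C(ℝ, E →L[𝕜] E)} {P P' : E →L[𝕜] E} {N ν : ℝ}

theorem norm_greenFunction_le (h : DichotomyWith A P N ν) {t τ : ℝ} (hne : τ ≠ t) :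
    ‖greenFunction A P t τ‖ ≤ N * Real.exp (-ν * |t - τ|) := by
  rw [greenFunction]
  split_ifs with hlt
  · rw [abs_of_pos (sub_pos.2 hlt)]
    exact h.stable t τ hlt
  · have hlt' : t < τ := lt_of_le_of_ne (not_lt.1 hlt) hne.symm
    rw [norm_neg, abs_of_neg (sub_neg.2 hlt'), neg_mul_neg]
    exact h.unstable t τ hlt'

theorem timeShift (h : DichotomyWith A P N ν) (s : ℝ) :
    DichotomyWith (_root_.timeShift s A) (conjCauchy A P s s) N ν where
  idem := by
    have e : conjCauchy A P s s * conjCauchy A P s s = cauchyOperator A s * P *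
        (Ring.inverse (cauchyOperator A s) * cauchyOperator A s) * P *
        Ring.inverse (cauchyOperator A s) := by
      simp only [conjCauchy, mul_assoc]
    rw [IsIdempotentElem, e, inverse_mul_cauchyOperator, mul_one,
      mul_assoc (cauchyOperator A s) P P, h.idem.eq, conjCauchy]
  stable t τ hlt := by
    have := h.stable (t + s) (τ + s) (by linarith)
    rwa [conjCauchy_add, add_sub_add_right_eq_sub] at this
  unstable t τ hlt := by
    have := h.unstable (t + s) (τ + s) (by linarith)
    rwa [conjCauchy_add, add_sub_add_right_eq_sub, conjCauchy_one_sub_self] at this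

theorem of_tendsto {ι : Type*} {l : Filter ι} [l.NeBot] {a : ι → C(ℝ, E →L[𝕜] E)}
    {p : ι → E →L[𝕜] E} (h : ∀ i, DichotomyWith (a i) (p i) N ν) (ha : Tendsto a l (𝓝 A))
    {M : ℝ} (hM : ∀ i s, ‖a i s‖ ≤ M) (hp : Tendsto p l (𝓝 P)) : DichotomyWith A P N ν where
  idem := tendsto_nhds_unique (hp.mul hp) (hp.congr fun i => (h i).idem.eq.symm)
  stable t τ hlt := le_of_tendsto (tendsto_conjCauchy ha hM hp t τ).norm
    (Eventually.of_forall fun i => (h i).stable t τ hlt)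
  unstable t τ hlt := le_of_tendsto (tendsto_conjCauchy ha hM (hp.const_sub 1) t τ).norm
    (Eventually.of_forall fun i => (h i).unstable t τ hlt)

theorem norm_cauchyOperator_stable (h : DichotomyWith A P N ν) (hν : 0 < ν) (hN : 0 ≤ N) {t : ℝ}
    (ht : 0 < t) (x : E) : ‖cauchyOperator A t (P x)‖ ≤ N * ‖x‖ := by
  have h1 := h.stable t 0 ht
  have e : conjCauchy A P t 0 = cauchyOperator A t * P := by
    simp [conjCauchy, cauchyOperator_zero]
  have h2 := (conjCauchy A P t 0).le_of_opNorm_le (h1.trans (mul_le_of_le_one_right hN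
    (Real.exp_le_one_iff.2 (by nlinarith)))) x
  rwa [e] at h2

theorem norm_cauchyOperator_unstable (h : DichotomyWith A P N ν) (hν : 0 < ν) (hN : 0 ≤ N)
    {t : ℝ} (ht : t < 0) (x : E) : ‖cauchyOperator A t ((1 - P) x)‖ ≤ N * ‖x‖ := by
  have h1 := h.unstable t 0 ht
  have e : conjCauchy A (1 - P) t 0 = cauchyOperator A t * (1 - P) := by
    simp [conjCauchy, cauchyOperator_zero]
  have h2 := (conjCauchy A (1 - P) t 0).le_of_opNorm_le (h1.trans (mul_le_of_le_one_right hN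
    (Real.exp_le_one_iff.2 (by nlinarith)))) x
  rwa [e] at h2

/-- A bounded orbit is transported back to time `0`: from `τ → -∞` the stable estimate kills `P x`,
from `τ → +∞` the unstable one kills `(1 - P) x`. -/
theorem eq_zero_of_bounded (h : DichotomyWith A P N ν) (hν : 0 < ν) {x : E} {C : ℝ}
    (hx : ∀ t, ‖cauchyOperator A t x‖ ≤ C) : x = 0 := by
  have key : ∀ S : E →L[𝕜] E, ∀ τ, conjCauchy A S 0 τ (cauchyOperator A τ x) = S x := by
    intro S τ
    have : conjCauchy A S 0 τ * cauchyOperator A τ = S := by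
      rw [conjCauchy, mul_assoc, inverse_mul_cauchyOperator, cauchyOperator_zero, mul_one, one_mul]
    conv_rhs => rw [← this]
    rfl
  have hlim : Tendsto (fun s : ℝ => N * Real.exp (-ν * s) * C) atTop (𝓝 0) := by
    have : Tendsto (fun s : ℝ => Real.exp (-ν * s)) atTop (𝓝 0) :=
      Real.tendsto_exp_atBot.comp (tendsto_id.const_mul_atTop_of_neg (neg_neg_of_pos hν))
    simpa using (this.const_mul N).mul_const C
  have hP : P x = 0 := by
    refine norm_le_zero_iff.1 (ge_of_tendsto hlim ?_)
    filter_upwards [eventually_gt_atTop 0] with s hs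
    rw [← key P (-s)]
    refine ContinuousLinearMap.le_of_opNorm_le_of_le _ ?_ (hx _)
    simpa using h.stable 0 (-s) (by linarith)
  have hQ : (1 - P) x = 0 := by
    refine norm_le_zero_iff.1 (ge_of_tendsto hlim ?_)
    filter_upwards [eventually_gt_atTop 0] with s hs
    rw [← key (1 - P) s]
    refine ContinuousLinearMap.le_of_opNorm_le_of_le _ ?_ (hx _)
    simpa using h.unstable 0 s hs
  simpa [hP] using hQ

/-- The orbits of `(1 - P') P x` and of `P' (1 - P) x` are bounded on the whole line: one half-line
uses a single dichotomy estimate, the other a difference of two. Both vectors therefore vanish,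
whence `P = P' P = P'`. -/
theorem projection_unique (h : DichotomyWith A P N ν) (h' : DichotomyWith A P' N ν) (hν : 0 < ν)
    (hN : 0 ≤ N) : P = P' := by
  have h1 : P = P' * P := by
    ext x
    have : (1 - P') (P x) = 0 := by
      refine h.eq_zero_of_bounded hν (C := N * ‖x‖ + N * ‖P x‖ + ‖(1 - P') (P x)‖) fun t => ?_
      have p1 : 0 ≤ N * ‖x‖ := by positivity
      have p2 : 0 ≤ N * ‖P x‖ := by positivity
      have p3 := norm_nonneg ((1 - P') (P x))
      rcases lt_trichotomy t 0 with ht | rfl | ht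
      · linarith [h'.norm_cauchyOperator_unstable hν hN ht (P x)]
      · rw [cauchyOperator_zero]
        simp only [one_apply_eq_self]
        linarith
      · have e : (1 - P') (P x) = P x - P' (P x) := rfl
        have := norm_sub_le (cauchyOperator A t (P x)) (cauchyOperator A t (P' (P x)))
        rw [e, map_sub, ← e]
        linarith [h.norm_cauchyOperator_stable hν hN ht x,
          h'.norm_cauchyOperator_stable hν hN ht (P x)]
    exact sub_eq_zero.1 this
  have h2 : P' = P' * P := by
    ext x
    have : P' ((1 - P) x) = 0 := by
      refine h.eq_zero_of_bounded hν
        (C := N * ‖x‖ + N * ‖(1 - P) x‖ + ‖P' ((1 - P) x)‖) fun t => ?_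
      have p1 : 0 ≤ N * ‖x‖ := by positivity
      have p2 : 0 ≤ N * ‖(1 - P) x‖ := by positivity
      have p3 := norm_nonneg (P' ((1 - P) x))
      rcases lt_trichotomy t 0 with ht | rfl | ht
      · have e : P' ((1 - P) x) = (1 - P) x - (1 - P') ((1 - P) x) := by
          simp
        have := norm_sub_le (cauchyOperator A t ((1 - P) x))
          (cauchyOperator A t ((1 - P') ((1 - P) x)))
        rw [← map_sub, ← e] at this
        linarith [h.norm_cauchyOperator_unstable hν hN ht x,
          h'.norm_cauchyOperator_unstable hν hN ht ((1 - P) x)]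
      · rw [cauchyOperator_zero]
        simp only [one_apply_eq_self]
        linarith
      · linarith [h'.norm_cauchyOperator_stable hν hN ht ((1 - P) x)]
    have e : P' ((1 - P) x) = P' x - P' (P x) := by simp
    exact sub_eq_zero.1 (e ▸ this)
  rw [h1, ← h2]

/-- Under Condition (C) the projections `P(t n)` converge as soon as the translates of `A` do. -/
theorem exists_tendsto_projection (h : DichotomyWith A P N ν) (hν : 0 < ν) (hN : 0 ≤ N)
    (hC : ConditionC A P) {M : ℝ} (hM : ∀ s, ‖A s‖ ≤ M) {t : ℕ → ℝ} {B : C(ℝ, E →L[𝕜] E)}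
    (hB : Tendsto (fun n => _root_.timeShift (t n) A) atTop (𝓝 B)) :
    ∃ S, Tendsto (fun n => conjCauchy A P (t n) (t n)) atTop (𝓝 S) := by
  have hmem : ∀ n, conjCauchy A P (t n) (t n) ∈ closure (range fun s => conjCauchy A P s s) :=
    fun n => subset_closure ⟨t n, rfl⟩
  have hdich : ∀ {u : ℕ → ℕ} {S : E →L[𝕜] E}, StrictMono u →
      Tendsto ((fun n => conjCauchy A P (t n) (t n)) ∘ u) atTop (𝓝 S) →
      DichotomyWith B S N ν := fun {u S} hu hS =>
    DichotomyWith.of_tendsto (a := fun n => _root_.timeShift (t (u n)) A)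
      (fun n => h.timeShift (t (u n))) (hB.comp hu.tendsto_atTop) (fun _ _ => hM _) hS
  obtain ⟨S, -, u, hu, hS⟩ := hC.tendsto_subseq hmem
  -- In a compact set a sequence with a single cluster point converges; two cluster points would
  -- both be dichotomy projections of `B`.
  refine ⟨S, hC.tendsto_nhds_of_unique_mapClusterPt (Eventually.of_forall hmem) fun S' _ hS' => ?_⟩
  obtain ⟨v, hv, hS'⟩ := hS'.tendsto_subseq
  exact (hdich hv hS').projection_unique (hdich hu hS) hν hN

end DichotomyWith

end Dichotomy

/-! ### The Green integral: bounds, differentiability, continuity in the data. -/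

section GreenIntegral

theorem integrable_exp_neg_mul_abs {ν : ℝ} (hν : 0 < ν) :
    Integrable fun s : ℝ => Real.exp (-ν * |s|) := by
  rw [← integrableOn_univ, ← Iic_union_Ioi (a := (0 : ℝ)), integrableOn_union]
  constructor
  · refine (integrableOn_exp_mul_Iic hν 0).congr_fun (fun s hs => ?_) measurableSet_Iic
    simp only [abs_of_nonpos (mem_Iic.1 hs), neg_mul_neg]
  · refine (exp_neg_integrableOn_Ioi 0 hν).congr_fun (fun s hs => ?_) measurableSet_Ioi
    simp only [abs_of_pos (mem_Ioi.1 hs)]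

/-- The `L¹` norm of the exponential kernel `N e^{-ν|s|}`. -/
noncomputable def kernelMass (N ν : ℝ) : ℝ := ∫ s, N * Real.exp (-ν * |s|)

theorem integrable_kernel {ν : ℝ} (N : ℝ) (hν : 0 < ν) (t : ℝ) :
    Integrable fun τ : ℝ => N * Real.exp (-ν * |t - τ|) :=
  ((integrable_exp_neg_mul_abs hν).comp_sub_left t).const_mul N

theorem integral_kernel (N ν t : ℝ) :
    ∫ τ, N * Real.exp (-ν * |t - τ|) = kernelMass N ν :=
  integral_sub_left_eq_self (fun s => N * Real.exp (-ν * |s|)) volume t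

theorem kernelMass_nonneg {N : ℝ} (hN : 0 ≤ N) (ν : ℝ) : 0 ≤ kernelMass N ν :=
  integral_nonneg fun _ => by positivity

variable {𝕜 E : Type*} [RCLike 𝕜] [NormedAddCommGroup E] [NormedSpace ℝ E]
  [NormedSpace 𝕜 E] [IsScalarTower ℝ 𝕜 E] [CompleteSpace E]

/-- `∫ G_A(t, τ) g(τ) dτ`. -/
noncomputable def greenIntegral (A : C(ℝ, E →L[𝕜] E)) (P : E →L[𝕜] E) (g : ℝ → E) (t : ℝ) : E :=
  ∫ τ, greenFunction A P t τ (g τ)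

theorem greenIntegral_add (A : C(ℝ, E →L[𝕜] E)) (P : E →L[𝕜] E) (g : ℝ → E) (t h : ℝ) :
    greenIntegral A P g (t + h) =
      greenIntegral (timeShift h A) (conjCauchy A P h h) (fun τ => g (τ + h)) t := by
  simp only [greenIntegral, ← greenFunction_add]
  exact (integral_add_right_eq_self (fun τ => greenFunction A P (t + h) τ (g τ)) h).symm

theorem continuous_conjCauchy_apply (A : C(ℝ, E →L[𝕜] E)) (S : E →L[𝕜] E) {g : ℝ → E}
    (hg : Continuous g) (t : ℝ) : Continuous fun τ => conjCauchy A S t τ (g τ) :=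
  (continuous_const.mul (continuous_inverse_cauchyOperator A)).clm_apply hg

theorem aestronglyMeasurable_greenFunction (A : C(ℝ, E →L[𝕜] E)) (P : E →L[𝕜] E) {g : ℝ → E}
    (hg : Continuous g) (t : ℝ) :
    AEStronglyMeasurable fun τ => greenFunction A P t τ (g τ) := by
  have e : (fun τ => greenFunction A P t τ (g τ)) = fun τ =>
      if τ < t then conjCauchy A P t τ (g τ) else -conjCauchy A (1 - P) t τ (g τ) := by
    funext τ
    simp only [greenFunction]
    split_ifs <;> rfl
  rw [e]
  exact (StronglyMeasurable.ite measurableSet_Iio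
    (continuous_conjCauchy_apply A P hg t).stronglyMeasurable
    (continuous_conjCauchy_apply A (1 - P) hg t).neg.stronglyMeasurable).aestronglyMeasurable

namespace DichotomyWith

variable {A : C(ℝ, E →L[𝕜] E)} {P : E →L[𝕜] E} {N ν : ℝ}

theorem ae_norm_greenFunction_le (h : DichotomyWith A P N ν) (t : ℝ) :
    ∀ᵐ τ, ‖greenFunction A P t τ‖ ≤ N * Real.exp (-ν * |t - τ|) := by
  filter_upwards [compl_mem_ae_iff.2 (measure_singleton t)] with τ hτ
  exact h.norm_greenFunction_le hτ

theorem ae_norm_greenFunction_apply_le (h : DichotomyWith A P N ν) {g : ℝ → E} {r : ℝ → ℝ}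
    (hb : ∀ τ, ‖g τ‖ ≤ r τ) (t : ℝ) :
    ∀ᵐ τ, ‖greenFunction A P t τ (g τ)‖ ≤ N * Real.exp (-ν * |t - τ|) * r τ := by
  filter_upwards [h.ae_norm_greenFunction_le t] with τ hτ
  exact ContinuousLinearMap.le_of_opNorm_le_of_le _ hτ (hb τ)

theorem integrable_greenFunction (h : DichotomyWith A P N ν) (hν : 0 < ν) {g : ℝ → E}
    (hg : Continuous g) {B : ℝ} (hb : ∀ τ, ‖g τ‖ ≤ B) (t : ℝ) :
    Integrable fun τ => greenFunction A P t τ (g τ) :=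
  ((integrable_kernel N hν t).mul_const B).mono'
    (aestronglyMeasurable_greenFunction A P hg t) (h.ae_norm_greenFunction_apply_le hb t)

theorem norm_greenIntegral_le_integral (h : DichotomyWith A P N ν) {g : ℝ → E} {r : ℝ → ℝ}
    (hb : ∀ τ, ‖g τ‖ ≤ r τ) (t : ℝ)
    (hr : Integrable fun τ => N * Real.exp (-ν * |t - τ|) * r τ) :
    ‖greenIntegral A P g t‖ ≤ ∫ τ, N * Real.exp (-ν * |t - τ|) * r τ :=
  norm_integral_le_of_norm_le hr (h.ae_norm_greenFunction_apply_le hb t)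

theorem norm_greenIntegral_le (h : DichotomyWith A P N ν) (hν : 0 < ν) {g : ℝ → E} {B : ℝ}
    (hb : ∀ τ, ‖g τ‖ ≤ B) (t : ℝ) : ‖greenIntegral A P g t‖ ≤ kernelMass N ν * B := by
  have := h.norm_greenIntegral_le_integral hb t ((integrable_kernel N hν t).mul_const B)
  rwa [integral_mul_const, integral_kernel] at this

theorem greenIntegral_sub (h : DichotomyWith A P N ν) (hν : 0 < ν) {g k : ℝ → E}
    (hg : Continuous g) (hk : Continuous k) {B C : ℝ} (hB : ∀ τ, ‖g τ‖ ≤ B)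
    (hC : ∀ τ, ‖k τ‖ ≤ C) (t : ℝ) :
    greenIntegral A P g t - greenIntegral A P k t = greenIntegral A P (fun τ => g τ - k τ) t := by
  simp only [greenIntegral, map_sub]
  exact (integral_sub (h.integrable_greenFunction hν hg hB t)
    (h.integrable_greenFunction hν hk hC t)).symm

/-- The Green integral of a bounded continuous function `g` solves `x' = A(t) x + g(t)`. -/
theorem hasDerivAt_greenIntegral (h : DichotomyWith A P N ν) (hν : 0 < ν) {g : ℝ → E}
    (hg : Continuous g) {B : ℝ} (hb : ∀ τ, ‖g τ‖ ≤ B) (t : ℝ) :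
    HasDerivAt (greenIntegral A P g) (A t (greenIntegral A P g t) + g t) t := by
  -- Off the diagonal the kernel splits as `U(t)` times a factor independent of `t`, so the Green
  -- integral is `U(t) y(t)` with `y` built from primitives of `W P` and `W (1 - P)`.
  set W : (E →L[𝕜] E) → ℝ → E := fun S τ => (S * Ring.inverse (cauchyOperator A τ)) (g τ) with hW
  have hWc : ∀ S, Continuous (W S) := fun S =>
    (continuous_const.mul (continuous_inverse_cauchyOperator A)).clm_apply hg
  have hconj : ∀ S t τ, conjCauchy A S t τ (g τ) = cauchyOperator A t (W S τ) := fun S t τ => by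
    simp only [conjCauchy, mul_assoc, hW]; rfl
  have hinv : ∀ t x, Ring.inverse (cauchyOperator A t) (cauchyOperator A t x) = x := fun t x =>
    congrArg (fun S : E →L[𝕜] E => S x) (inverse_mul_cauchyOperator A t)
  have hG1 : ∀ t, EqOn (fun τ => greenFunction A P t τ (g τ))
      (fun τ => cauchyOperator A t (W P τ)) (Iio t) := fun t τ hτ => by
    simp only [greenFunction, if_pos (mem_Iio.1 hτ), hconj]
  have hG2 : ∀ t, EqOn (fun τ => greenFunction A P t τ (g τ))
      (fun τ => -cauchyOperator A t (W (1 - P) τ)) (Ioi t) := fun t τ hτ => by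
    simp only [greenFunction, if_neg (mem_Ioi.1 hτ).le.not_gt, neg_apply, hconj]
  -- Integrability on the half-lines is inherited from the Green kernel by applying the bounded
  -- operator `U⁻¹(t)`.
  have hi1 : ∀ t, IntegrableOn (W P) (Iic t) := fun t => by
    rw [integrableOn_Iic_iff_integrableOn_Iio]
    have := ((h.integrable_greenFunction hν hg hb t).integrableOn.congr_fun (hG1 t)
      measurableSet_Iio)
    simpa only [IntegrableOn, hinv] using
      (Ring.inverse (cauchyOperator A t)).integrable_comp this
  have hi2 : ∀ t, IntegrableOn (W (1 - P)) (Ioi t) := fun t => by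
    have := ((h.integrable_greenFunction hν hg hb t).integrableOn.congr_fun (hG2 t)
      measurableSet_Ioi).neg
    have := (Ring.inverse (cauchyOperator A t)).integrable_comp this
    simpa only [IntegrableOn, Pi.neg_apply, neg_neg, hinv] using this
  set y : ℝ → E := fun t => (∫ τ in Iic t, W P τ) - ∫ τ in Ioi t, W (1 - P) τ with hy
  have hrep : greenIntegral A P g = fun t => cauchyOperator A t (y t) := by
    funext t
    have hint := h.integrable_greenFunction hν hg hb t
    rw [greenIntegral, ← intervalIntegral.integral_Iic_add_Ioi hint.integrableOn
      hint.integrableOn, integral_Iic_eq_integral_Iio, setIntegral_congr_fun measurableSet_Iio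
      (hG1 t), setIntegral_congr_fun measurableSet_Ioi (hG2 t), integral_neg,
      ContinuousLinearMap.integral_comp_comm _
        ((integrableOn_Iic_iff_integrableOn_Iio).1 (hi1 t)),
      ContinuousLinearMap.integral_comp_comm _ (hi2 t), ← integral_Iic_eq_integral_Iio,
      ← sub_eq_add_neg, ← map_sub]
  have hy' : HasDerivAt y (W P t + W (1 - P) t) t := by
    have e : y = fun t => y 0 + ((∫ τ in (0 : ℝ)..t, W P τ) + ∫ τ in (0 : ℝ)..t, W (1 - P) τ) := by
      funext t
      simp only [hy]
      rw [← intervalIntegral.integral_Iic_sub_Iic (hi1 0) (hi1 t),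
        ← intervalIntegral.integral_Ioi_sub_Ioi' (hi2 0) (hi2 t)]
      abel
    rw [e]
    exact ((intervalIntegral.integral_hasDerivAt_right ((hWc _).intervalIntegrable _ _)
      (hWc _).aestronglyMeasurable.stronglyMeasurableAtFilter (hWc _).continuousAt).add
      (intervalIntegral.integral_hasDerivAt_right ((hWc _).intervalIntegrable _ _)
      (hWc _).aestronglyMeasurable.stronglyMeasurableAtFilter (hWc _).continuousAt)).const_add _
  -- The jump of Green's function across the diagonal, `P + (1 - P) = 1`, produces the inhomogeneity
  -- `g`.
  have hsum : cauchyOperator A t (W P t + W (1 - P) t) = g t := by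
    have e : W P t + W (1 - P) t = Ring.inverse (cauchyOperator A t) (g t) := by
      simp [hW]
    rw [e]
    exact congrArg (fun S : E →L[𝕜] E => S (g t)) (cauchyOperator_mul_inverse A t)
  have := (hasDerivAt_cauchyOperator A t).clm_apply_real hy'
  rw [hsum] at this
  rw [hrep]
  exact this

variable {ι : Type*} {l : Filter ι} [l.IsCountablyGenerated] {a : ι → C(ℝ, E →L[𝕜] E)}
  {p : ι → E →L[𝕜] E} {g : ι → ℝ → E} {B M : ℝ}

/-- The Green integrals with respect to converging equations, of uniformly bounded functions,
are asymptotic to those with respect to the limit equation. -/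
theorem tendsto_greenIntegral_sub (h : DichotomyWith A P N ν) (hν : 0 < ν)
    (ha : ∀ i, DichotomyWith (a i) (p i) N ν) (hM : ∀ i s, ‖a i s‖ ≤ M)
    (haA : Tendsto a l (𝓝 A)) (hpP : Tendsto p l (𝓝 P)) (hg : ∀ i, Continuous (g i))
    (hB : ∀ i τ, ‖g i τ‖ ≤ B) (t : ℝ) :
    Tendsto (fun i => greenIntegral (a i) (p i) (g i) t - greenIntegral A P (g i) t) l (𝓝 0) := by
  have e : ∀ i, greenIntegral (a i) (p i) (g i) t - greenIntegral A P (g i) t =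
      ∫ τ, (greenFunction (a i) (p i) t τ (g i τ) - greenFunction A P t τ (g i τ)) := fun i =>
    (integral_sub ((ha i).integrable_greenFunction hν (hg i) (hB i) t)
      (h.integrable_greenFunction hν (hg i) (hB i) t)).symm
  simp only [e]
  rw [← integral_zero ℝ E (μ := volume)]
  have hint := (integrable_kernel N hν t).mul_const B
  refine tendsto_integral_filter_of_dominated_convergence
    (fun τ => N * Real.exp (-ν * |t - τ|) * B + N * Real.exp (-ν * |t - τ|) * B)
    (Eventually.of_forall fun i => (aestronglyMeasurable_greenFunction _ _ (hg i) t).sub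
      (aestronglyMeasurable_greenFunction _ _ (hg i) t))
    (Eventually.of_forall fun i => ?_) (hint.add hint) (Eventually.of_forall fun τ => ?_)
  · filter_upwards [(ha i).ae_norm_greenFunction_apply_le (hB i) t,
      h.ae_norm_greenFunction_apply_le (hB i) t] with τ h1 h2
    exact (norm_sub_le _ _).trans (add_le_add h1 h2)
  · have h1 : Tendsto (fun i => ‖greenFunction (a i) (p i) t τ - greenFunction A P t τ‖ * B) l
        (𝓝 0) := by
      simpa using ((tendsto_greenFunction haA hM hpP t τ).sub_const
        (greenFunction A P t τ)).norm.mul_const B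
    refine squeeze_zero_norm (fun i => ?_) h1
    rw [← sub_apply]
    exact ContinuousLinearMap.le_opNorm_of_le _ (hB i τ)

theorem tendsto_greenIntegral (h : DichotomyWith A P N ν) (hν : 0 < ν)
    (ha : ∀ i, DichotomyWith (a i) (p i) N ν) (hM : ∀ i s, ‖a i s‖ ≤ M)
    (haA : Tendsto a l (𝓝 A)) (hpP : Tendsto p l (𝓝 P)) (hg : ∀ i, Continuous (g i))
    (hB : ∀ i τ, ‖g i τ‖ ≤ B) {k : ℝ → E} (hk : ∀ τ, Tendsto (fun i => g i τ) l (𝓝 (k τ)))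
    (t : ℝ) :
    Tendsto (fun i => greenIntegral (a i) (p i) (g i) t) l (𝓝 (greenIntegral A P k t)) := by
  have h1 : Tendsto (fun i => greenIntegral A P (g i) t) l (𝓝 (greenIntegral A P k t)) :=
    tendsto_integral_filter_of_dominated_convergence
      (fun τ => N * Real.exp (-ν * |t - τ|) * B)
      (Eventually.of_forall fun i => aestronglyMeasurable_greenFunction _ _ (hg i) t)
      (Eventually.of_forall fun i => h.ae_norm_greenFunction_apply_le (hB i) t)
      ((integrable_kernel N hν t).mul_const B)
      (Eventually.of_forall fun τ => (greenFunction A P t τ).continuous.tendsto _ |>.comp (hk τ))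
  simpa using (h.tendsto_greenIntegral_sub hν ha hM haA hpP hg hB t).add h1

end DichotomyWith

end GreenIntegral

/-! ### Compactness of translates: bounds and convergent subsequences. -/

section LagrangeStability

theorem exists_norm_le_of_lagrangeStable {X : Type*} [SeminormedAddCommGroup X] {φ : C(ℝ, X)}
    (h : LagrangeStable φ) : ∃ B, ∀ t, ‖φ t‖ ≤ B := by
  obtain ⟨B, hB⟩ := (h.image (continuous_eval_const (F := C(ℝ, X)) (0 : ℝ))).isBounded.exists_norm_le
  refine ⟨B, fun t => hB _ ⟨timeShift t φ, subset_closure ⟨t, rfl⟩, ?_⟩⟩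
  simp

theorem exists_norm_le_of_lagrangeStable₂ {Y X : Type*} [TopologicalSpace Y]
    [SeminormedAddCommGroup X] {F : C(ℝ × Y, X)} (h : LagrangeStable₂ F) (y : Y) :
    ∃ B, ∀ t, ‖F (t, y)‖ ≤ B := by
  obtain ⟨B, hB⟩ :=
    (h.image (continuous_eval_const (F := C(ℝ × Y, X)) ((0 : ℝ), y))).isBounded.exists_norm_le
  refine ⟨B, fun t => hB _ ⟨timeShift₂ t F, subset_closure ⟨t, rfl⟩, ?_⟩⟩
  simp [timeShift₂]

theorem LagrangeStable.tendsto_subseq {X : Type*} [SeminormedAddCommGroup X] {φ : C(ℝ, X)}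
    (h : LagrangeStable φ) (t : ℕ → ℝ) : ∃ u : ℕ → ℕ, StrictMono u ∧
      ∃ ψ, Tendsto (fun n => timeShift (t (u n)) φ) atTop (𝓝 ψ) := by
  obtain ⟨ψ, -, u, hu, hψ⟩ := IsCompact.tendsto_subseq h (x := fun n => timeShift (t n) φ)
    fun n => subset_closure ⟨t n, rfl⟩
  exact ⟨u, hu, ψ, hψ⟩

/-- On `ℝ × Q` with `Q` compact, unlike on `ℝ × Y`, the compact-open topology is metrizable. -/
theorem LagrangeStable₂.tendsto_subseq_restrictSpace {Y X : Type*} [TopologicalSpace Y]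
    [SeminormedAddCommGroup X] {F : C(ℝ × Y, X)} (h : LagrangeStable₂ F) {Q : Set Y}
    (hQ : IsCompact Q) (t : ℕ → ℝ) : ∃ u : ℕ → ℕ, StrictMono u ∧
      ∃ H, Tendsto (fun n => timeShift₂ (t (u n)) (restrictSpace F Q)) atTop (𝓝 H) := by
  have := isCompact_iff_compactSpace.1 hQ
  let i : C(ℝ × Q, ℝ × Y) := ⟨fun p => (p.1, (p.2 : Y)), by fun_prop⟩
  have hK := h.image (ContinuousMap.continuous_precomp (Z := X) i)
  obtain ⟨H, -, u, hu, hH⟩ := hK.tendsto_subseq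
    (x := fun n => timeShift₂ (t n) (restrictSpace F Q))
    fun n => ⟨timeShift₂ (t n) F, subset_closure ⟨t n, rfl⟩, rfl⟩
  exact ⟨u, hu, H, hH⟩

/-- Every sequence of translates of `ψ` has a pointwise convergent subsequence. -/
def ShiftPrecompact {X : Type*} [TopologicalSpace X] (ψ : ℝ → X) : Prop :=
  ∀ t : ℕ → ℝ, ∃ u : ℕ → ℕ, StrictMono u ∧
    ∃ χ : ℝ → X, ∀ s, Tendsto (fun n => ψ (s + t (u n))) atTop (𝓝 (χ s))

theorem shiftPrecompact_const {X : Type*} [TopologicalSpace X] (c : X) :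
    ShiftPrecompact fun _ : ℝ => c :=
  fun _ => ⟨id, strictMono_id, fun _ => c, fun _ => tendsto_const_nhds⟩

/-- Points of the closure are approximated by values `ψ (t n)`, and these are the translates
evaluated at `0`. -/
theorem ShiftPrecompact.isCompact_closure_range {X : Type*} [PseudoMetricSpace X] {ψ : ℝ → X}
    (h : ShiftPrecompact ψ) : IsCompact (closure (range ψ)) := by
  refine IsSeqCompact.isCompact fun x hx => ?_
  have : ∀ n : ℕ, ∃ t, dist (x n) (ψ t) < 1 / ((n : ℝ) + 1) := fun n => by
    obtain ⟨_, ⟨t, rfl⟩, ht⟩ := Metric.mem_closure_iff.1 (hx n) _ (Nat.one_div_pos_of_nat (n := n))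
    exact ⟨t, ht⟩
  choose t ht using this
  obtain ⟨u, hu, χ, hχ⟩ := h t
  have h0 := hχ 0
  simp only [zero_add] at h0
  refine ⟨χ 0, mem_closure_of_tendsto h0 (Eventually.of_forall fun n => ⟨_, rfl⟩), u, hu,
    (tendsto_iff_of_dist ?_).2 h0⟩
  exact squeeze_zero (fun _ => dist_nonneg) (fun n => (ht (u n)).le)
    (tendsto_one_div_add_atTop_nhds_zero_nat.comp hu.tendsto_atTop)

theorem totallyBounded_range_of_tendstoUniformly {T X : Type*} [PseudoMetricSpace X]
    {ψ : ℕ → T → X} {φ : T → X} (h : TendstoUniformly ψ φ atTop)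
    (hψ : ∀ n, TotallyBounded (range (ψ n))) : TotallyBounded (range φ) := by
  refine Metric.totallyBounded_iff.2 fun e he => ?_
  obtain ⟨n, hn⟩ := (Metric.tendstoUniformly_iff.1 h (e / 2) (half_pos he)).exists
  obtain ⟨c, hc, hcov⟩ := Metric.totallyBounded_iff.1 (hψ n) (e / 2) (half_pos he)
  refine ⟨c, hc, ?_⟩
  rintro _ ⟨s, rfl⟩
  obtain ⟨y, hy, hd⟩ := mem_iUnion₂.1 (hcov ⟨s, rfl⟩)
  refine mem_iUnion₂.2 ⟨y, hy, ?_⟩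
  rw [Metric.mem_ball] at hd ⊢
  linarith [dist_triangle (φ s) (ψ n s) y, hn s]

end LagrangeStability

/-! ### The fixed point of the Green operator and the compactness of its range. -/

section BoundedSolution

theorem tendsto_timeShift_apply {Y ι : Type*} [TopologicalSpace Y] {l : Filter ι} {φ ψ : C(ℝ, Y)}
    {t : ι → ℝ} (h : Tendsto (fun i => timeShift (t i) φ) l (𝓝 ψ)) (s : ℝ) :
    Tendsto (fun i => φ (s + t i)) l (𝓝 (ψ s)) :=
  ((continuous_eval_const s).tendsto ψ).comp h

theorem tendsto_timeShift₂_restrictSpace_apply {X Y ι : Type*} [TopologicalSpace X]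
    [TopologicalSpace Y] {l : Filter ι} {F : C(ℝ × X, Y)} {Q : Set X} {H : C(ℝ × Q, Y)}
    {t : ι → ℝ} (h : Tendsto (fun i => timeShift₂ (t i) (restrictSpace F Q)) l (𝓝 H)) (s : ℝ)
    (x : Q) : Tendsto (fun i => F (s + t i, (x : X))) l (𝓝 (H (s, x))) :=
  ((continuous_eval_const (s, x)).tendsto H).comp h

theorem exists_norm_comp_le {E : Type*} [NormedAddCommGroup E] {F : C(ℝ × E, E)} {L : ℝ}
    (hF : LagrangeStable₂ F) (hL : 0 ≤ L)
    (hLip : ∀ t x y, ‖F (t, x) - F (t, y)‖ ≤ L * ‖x - y‖) (ψ : ℝ →ᵇ E) :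
    ∃ B, ∀ τ, ‖F (τ, ψ τ)‖ ≤ B := by
  obtain ⟨B₀, hB₀⟩ := exists_norm_le_of_lagrangeStable₂ hF 0
  refine ⟨L * ‖ψ‖ + B₀, fun τ => ?_⟩
  have h1 := norm_add_le (F (τ, ψ τ) - F (τ, 0)) (F (τ, 0))
  have h2 := hLip τ (ψ τ) 0
  rw [sub_add_cancel] at h1
  rw [sub_zero] at h2
  linarith [hB₀ τ, mul_le_mul_of_nonneg_left (ψ.norm_coe_le_norm τ) hL]

theorem exists_norm_forcing_le {𝕜 E : Type*} [RCLike 𝕜] [NormedAddCommGroup E]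
    [NormedSpace 𝕜 E] {f : C(ℝ, E)} {F : C(ℝ × E, E)} {L : ℝ}
    (hf : LagrangeStable f) (hF : LagrangeStable₂ F) (hL : 0 ≤ L)
    (hLip : ∀ t x y, ‖F (t, x) - F (t, y)‖ ≤ L * ‖x - y‖) (ε : 𝕜) (ψ : ℝ →ᵇ E) :
    ∃ B, ∀ τ, ‖f τ + ε • F (τ, ψ τ)‖ ≤ B := by
  obtain ⟨Bf, hBf⟩ := exists_norm_le_of_lagrangeStable hf
  obtain ⟨C, hC⟩ := exists_norm_comp_le hF hL hLip ψ
  refine ⟨Bf + ‖ε‖ * C, fun τ => (norm_add_le _ _).trans (add_le_add (hBf τ) ?_)⟩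
  rw [norm_smul]
  exact mul_le_mul_of_nonneg_left (hC τ) (norm_nonneg _)

variable {𝕜 E : Type*} [RCLike 𝕜] [NormedAddCommGroup E] [NormedSpace ℝ E]
  [NormedSpace 𝕜 E] [IsScalarTower ℝ 𝕜 E] [CompleteSpace E]
  {A : C(ℝ, E →L[𝕜] E)} {f : C(ℝ, E)} {F : C(ℝ × E, E)} {P : E →L[𝕜] E} {N ν L : ℝ}

/-- Successive subsequences make the translates of `ψ`, `A`, `f` and `F` on `closure (range ψ)`
converge; the projections then converge of themselves, and dominated convergence passes to the limit
in the Green integral. -/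
theorem ShiftPrecompact.greenIntegral (h : DichotomyWith A P N ν) (hν : 0 < ν) (hN : 0 ≤ N)
    (hC : ConditionC A P) (hA : LagrangeStable A) (hf : LagrangeStable f)
    (hF : LagrangeStable₂ F) (hLip : ∀ t x y, ‖F (t, x) - F (t, y)‖ ≤ L * ‖x - y‖) (ε : 𝕜)
    {ψ : ℝ → E} (hψ : Continuous ψ) {B : ℝ} (hB : ∀ τ, ‖f τ + ε • F (τ, ψ τ)‖ ≤ B)
    (hS : ShiftPrecompact ψ) :
    ShiftPrecompact (greenIntegral A P fun τ => f τ + ε • F (τ, ψ τ)) := by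
  intro t
  obtain ⟨M, hM⟩ := exists_norm_le_of_lagrangeStable hA
  have hQ := hS.isCompact_closure_range
  obtain ⟨u₁, hu₁, χ, hχ⟩ := hS t
  obtain ⟨u₂, hu₂, A', hA'⟩ := hA.tendsto_subseq (t ∘ u₁)
  obtain ⟨u₃, hu₃, f', hf'⟩ := hf.tendsto_subseq (t ∘ u₁ ∘ u₂)
  obtain ⟨u₄, hu₄, H, hH⟩ := hF.tendsto_subseq_restrictSpace hQ (t ∘ u₁ ∘ u₂ ∘ u₃)
  obtain ⟨S, hS'⟩ := h.exists_tendsto_projection hν hN hC hM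
    (t := t ∘ u₁ ∘ u₂ ∘ u₃ ∘ u₄) (hA'.comp (hu₃.comp hu₄).tendsto_atTop)
  have hχQ : ∀ s, χ s ∈ closure (range ψ) := fun s =>
    mem_closure_of_tendsto (hχ s) (Eventually.of_forall fun n => ⟨_, rfl⟩)
  refine ⟨u₁ ∘ u₂ ∘ u₃ ∘ u₄, hu₁.comp (hu₂.comp (hu₃.comp hu₄)),
    _root_.greenIntegral A' S fun τ => f' τ + ε • H (τ, ⟨χ τ, hχQ τ⟩), fun s => ?_⟩
  simp only [greenIntegral_add]
  have hA'' : Tendsto (fun n => timeShift (t (u₁ (u₂ (u₃ (u₄ n))))) A) atTop (𝓝 A') :=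
    hA'.comp (hu₃.comp hu₄).tendsto_atTop
  have hdich := fun n => h.timeShift (t (u₁ (u₂ (u₃ (u₄ n)))))
  refine (DichotomyWith.of_tendsto hdich hA'' (fun _ _ => hM _) hS').tendsto_greenIntegral hν
    hdich (fun _ _ => hM _) hA'' hS' (fun n => by fun_prop) (fun n τ => hB _) (fun τ => ?_) s
  refine ((tendsto_timeShift_apply hf' τ).comp hu₄.tendsto_atTop).add (Tendsto.const_smul ?_ ε)
  have h1 := tendsto_timeShift₂_restrictSpace_apply hH τ ⟨χ τ, hχQ τ⟩
  have h2 := (hχ τ).comp (hu₂.comp (hu₃.comp hu₄)).tendsto_atTop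
  -- The Lipschitz condition replaces the moving argument of `F` by its limit `χ τ`, a fixed point
  -- of the compact set, where the translates of `F` converge.
  have h3 : Tendsto (fun n => L * ‖ψ (τ + t (u₁ (u₂ (u₃ (u₄ n))))) - χ τ‖) atTop (𝓝 0) := by
    simpa using ((h2.sub_const (χ τ)).norm.const_mul L)
  simpa using (squeeze_zero_norm (fun n => hLip (τ + t (u₁ (u₂ (u₃ (u₄ n))))) _ _) h3).add h1

/-- The Green integral equation of `x' = A(t) x + f(t) + ε F(t, x)` has a solution with
relatively compact range. -/
theorem exists_eq_greenIntegral (h : DichotomyWith A P N ν) (hν : 0 < ν) (hN : 0 ≤ N)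
    (hC : ConditionC A P) (hA : LagrangeStable A) (hf : LagrangeStable f)
    (hF : LagrangeStable₂ F) (hL : 0 ≤ L)
    (hLip : ∀ t x y, ‖F (t, x) - F (t, y)‖ ≤ L * ‖x - y‖) {ε : 𝕜}
    (hε : kernelMass N ν * (‖ε‖ * L) ≤ 1 / 2) :
    ∃ φ : ℝ →ᵇ E, (∀ t, φ t = greenIntegral A P (fun τ => f τ + ε • F (τ, φ τ)) t) ∧
      IsCompact (closure (range φ)) := by
  have hc := kernelMass_nonneg hN ν
  have hbd := fun ψ => exists_norm_forcing_le hf hF hL hLip ε ψ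
  have hcont : ∀ ψ : ℝ →ᵇ E, Continuous fun τ => f τ + ε • F (τ, ψ τ) := fun ψ => by fun_prop
  have hex : ∀ ψ : ℝ →ᵇ E, ∃ χ : ℝ →ᵇ E,
      ⇑χ = greenIntegral A P (fun τ => f τ + ε • F (τ, ψ τ)) := fun ψ => by
    obtain ⟨B, hB⟩ := hbd ψ
    exact ⟨BoundedContinuousFunction.ofNormedAddCommGroup _
      (continuous_iff_continuousAt.2 fun t =>
        (h.hasDerivAt_greenIntegral hν (hcont ψ) hB t).continuousAt) _
      (h.norm_greenIntegral_le hν hB), rfl⟩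
  choose Φ hΦ using hex
  have hcontr : ContractingWith (1 / 2) Φ := by
    refine ⟨by norm_num, LipschitzWith.of_dist_le_mul fun ψ₁ ψ₂ => ?_⟩
    refine (BoundedContinuousFunction.dist_le (by positivity)).2 fun t => ?_
    obtain ⟨B₁, hB₁⟩ := hbd ψ₁
    obtain ⟨B₂, hB₂⟩ := hbd ψ₂
    rw [hΦ, hΦ, dist_eq_norm, h.greenIntegral_sub hν (hcont ψ₁) (hcont ψ₂) hB₁ hB₂]
    refine (h.norm_greenIntegral_le hν (B := ‖ε‖ * L * dist ψ₁ ψ₂) (fun τ => ?_) t).trans ?_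
    · rw [add_sub_add_left_eq_sub, ← smul_sub, norm_smul, mul_assoc]
      refine mul_le_mul_of_nonneg_left ((hLip _ _ _).trans (mul_le_mul_of_nonneg_left ?_ hL))
        (norm_nonneg _)
      rw [← dist_eq_norm]
      exact BoundedContinuousFunction.dist_coe_le_dist τ
    · rw [← mul_assoc]
      simpa using mul_le_mul_of_nonneg_right hε (dist_nonneg (x := ψ₁) (y := ψ₂))
  -- Only the iterates are shown to be shift precompact. For the fixed point, total boundedness of
  -- the range is enough, and it survives uniform limits.
  have hiter : ∀ k, ShiftPrecompact (Φ^[k] 0) := fun k => by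
    induction k with
    | zero => exact shiftPrecompact_const 0
    | succ k ih =>
      rw [Function.iterate_succ_apply', hΦ]
      obtain ⟨B, hB⟩ := hbd (Φ^[k] 0)
      exact ih.greenIntegral h hν hN hC hA hf hF hLip ε (map_continuous _) hB
  refine ⟨hcontr.fixedPoint Φ, fun t => ?_, ?_⟩
  · rw [← hΦ, hcontr.fixedPoint_isFixedPt.eq]
  · have h1 := BoundedContinuousFunction.tendsto_iff_tendstoUniformly.1
      (hcontr.tendsto_iterate_fixedPoint 0)
    have h2 := totallyBounded_range_of_tendstoUniformly h1 fun k =>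
      (hiter k).isCompact_closure_range.totallyBounded.subset subset_closure
    exact h2.closure.isCompact_of_isClosed isClosed_closure

end BoundedSolution

/-! ### Convergence of the translates of the solution. -/

section RemoteCompatibility

/-- The translates share one Lipschitz constant, which passes to the pointwise limit and makes the
convergence locally uniform. -/
theorem exists_tendsto_timeShift_of_lipschitzWith {Y : Type*} [PseudoMetricSpace Y]
    [CompleteSpace Y] {φ : C(ℝ, Y)} {K : NNReal} (hφ : LipschitzWith K φ) {t : ℕ → ℝ}
    (h : ∀ s, CauchySeq fun n => φ (s + t n)) :
    ∃ ψ, Tendsto (fun n => timeShift (t n) φ) atTop (𝓝 ψ) := by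
  choose χ hχ using fun s => cauchySeq_tendsto_of_complete (h s)
  have hd : ∀ n x y, dist (φ (x + t n)) (φ (y + t n)) ≤ K * dist x y := fun n x y => by
    simpa using hφ.dist_le_mul (x + t n) (y + t n)
  have hL : LipschitzWith K χ := LipschitzWith.of_dist_le_mul fun x y =>
    le_of_tendsto' ((hχ x).dist (hχ y)) fun n => hd n x y
  refine ⟨⟨χ, hL.continuous⟩, ContinuousMap.tendsto_of_tendstoLocallyUniformly
    (Metric.tendstoLocallyUniformly_iff.2 fun e he x => ?_)⟩
  -- Adding `1` keeps the radius meaningful when `K = 0`.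
  have hK : 0 < (K : ℝ) + 1 := by positivity
  have hr : 0 < e / 3 / ((K : ℝ) + 1) := by positivity
  refine ⟨_, Metric.ball_mem_nhds x hr, ?_⟩
  filter_upwards [Metric.tendsto_nhds.1 (hχ x) (e / 3) (by positivity)] with n hn y hy
  have hxy : K * dist y x ≤ e / 3 := by
    have h1 := (lt_div_iff₀ hK).1 (Metric.mem_ball.1 hy)
    nlinarith [dist_nonneg (x := y) (y := x)]
  have h2 := hL.dist_le_mul y x
  have h3 := hd n x y
  rw [dist_comm x y] at h3
  have h4 := dist_triangle4 (χ y) (χ x) (φ (x + t n)) (φ (y + t n))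
  rw [dist_comm (χ x)] at h4
  change dist (χ y) (φ (y + t n)) < e
  linarith

variable {𝕜 E : Type*} [RCLike 𝕜] [NormedAddCommGroup E] [NormedSpace ℝ E]
  [NormedSpace 𝕜 E] [IsScalarTower ℝ 𝕜 E] [CompleteSpace E]
  {A : C(ℝ, E →L[𝕜] E)} {f : C(ℝ, E)} {F : C(ℝ × E, E)} {P : E →L[𝕜] E} {N ν L : ℝ}

/-- The asymptotic bound `R` on `w i τ` is not uniform in `τ`. The excess of `‖w i τ‖` over `R` is
bounded and tends to `0` pointwise, so dominated convergence makes its contribution negligible. -/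
theorem DichotomyWith.eventually_norm_greenIntegral_le (h : DichotomyWith A P N ν) (hν : 0 < ν)
    (hN : 0 ≤ N) {ι : Type*} {l : Filter ι} [l.IsCountablyGenerated] {w : ι → ℝ → E}
    (hw : ∀ i, Continuous (w i)) {B R : ℝ} (hB : ∀ i τ, ‖w i τ‖ ≤ B) (hR : 0 ≤ R)
    (hlim : ∀ τ η, 0 < η → ∀ᶠ i in l, ‖w i τ‖ ≤ R + η) (s : ℝ) {η : ℝ} (hη : 0 < η) :
    ∀ᶠ i in l, ‖greenIntegral A P (w i) s‖ ≤ kernelMass N ν * R + η := by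
  set κ : ℝ → ℝ := fun τ => N * Real.exp (-ν * |s - τ|) with hκ
  have hκ0 : ∀ τ, 0 ≤ κ τ := fun τ => by positivity
  have hκc : Continuous κ := by fun_prop
  set r : ι → ℝ → ℝ := fun i τ => max (‖w i τ‖ - R) 0 with hr
  have hrc : ∀ i, Continuous (r i) := fun i => ((hw i).norm.sub continuous_const).max
    continuous_const
  have hr0 : ∀ i τ, 0 ≤ r i τ := fun i τ => le_max_right _ _
  have hrB : ∀ i τ, r i τ ≤ B := fun i τ =>
    max_le (by linarith [hB i τ]) ((norm_nonneg _).trans (hB i τ))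
  have hκi : Integrable κ := integrable_kernel N hν s
  have hbound : ∀ i, ∀ᵐ τ, ‖κ τ * r i τ‖ ≤ κ τ * B := fun i => Eventually.of_forall fun τ => by
    rw [Real.norm_of_nonneg (mul_nonneg (hκ0 τ) (hr0 i τ))]
    exact mul_le_mul_of_nonneg_left (hrB i τ) (hκ0 τ)
  have hκr : ∀ i, Integrable fun τ => κ τ * r i τ := fun i =>
    (hκi.mul_const B).mono' (hκc.mul (hrc i)).aestronglyMeasurable (hbound i)
  have hr_lim : ∀ τ, Tendsto (fun i => r i τ) l (𝓝 0) := fun τ => by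
    refine Metric.tendsto_nhds.2 fun e he => ?_
    filter_upwards [hlim τ (e / 2) (half_pos he)] with i hi
    rw [Real.dist_eq, sub_zero, abs_of_nonneg (hr0 i τ)]
    exact max_lt (by linarith) he
  have hlim' : Tendsto (fun i => ∫ τ, κ τ * r i τ) l (𝓝 0) := by
    rw [← integral_zero ℝ ℝ (μ := volume)]
    refine tendsto_integral_filter_of_dominated_convergence (fun τ => κ τ * B)
      (Eventually.of_forall fun i => (hκc.mul (hrc i)).aestronglyMeasurable)
      (Eventually.of_forall hbound) (hκi.mul_const B) (Eventually.of_forall fun τ => ?_)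
    simpa using (hr_lim τ).const_mul (κ τ)
  filter_upwards [hlim'.eventually (gt_mem_nhds hη)] with i hi
  have hsplit : (fun τ => κ τ * (R + r i τ)) = fun τ => κ τ * R + κ τ * r i τ := by
    funext τ; ring
  have h1 := h.norm_greenIntegral_le_integral (g := w i) (r := fun τ => R + r i τ)
    (fun τ => by linarith [le_max_left (‖w i τ‖ - R) 0]) s (by
      change Integrable fun τ => κ τ * (R + r i τ)
      rw [hsplit]
      exact (hκi.mul_const R).add (hκr i))
  refine h1.trans ?_
  change ∫ τ, κ τ * (R + r i τ) ≤ _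
  rw [hsplit, integral_add (hκi.mul_const R) (hκr i), integral_mul_const, integral_kernel]
  linarith

/-- The values of a solution of the Green integral equation are Cauchy along every sequence of
translations for which the translates of the coefficients converge. -/
theorem cauchySeq_of_eq_greenIntegral (h : DichotomyWith A P N ν) (hν : 0 < ν) (hN : 0 ≤ N)
    (hC : ConditionC A P) {M : ℝ} (hM : ∀ s, ‖A s‖ ≤ M) (hL : 0 ≤ L)
    (hLip : ∀ t x y, ‖F (t, x) - F (t, y)‖ ≤ L * ‖x - y‖) {ε : 𝕜}
    (hε : kernelMass N ν * (‖ε‖ * L) ≤ 1 / 2) {φ : ℝ →ᵇ E}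
    (hφ : ∀ t, φ t = greenIntegral A P (fun τ => f τ + ε • F (τ, φ τ)) t)
    (hQ : IsCompact (closure (range φ))) {B : ℝ} (hB : ∀ τ, ‖f τ + ε • F (τ, φ τ)‖ ≤ B)
    {t : ℕ → ℝ} {A' : C(ℝ, E →L[𝕜] E)} {f' : C(ℝ, E)} {H : C(ℝ × closure (range φ), E)}
    (hA' : Tendsto (fun n => timeShift (t n) A) atTop (𝓝 A'))
    (hf' : Tendsto (fun n => timeShift (t n) f) atTop (𝓝 f'))
    (hH : Tendsto (fun n => timeShift₂ (t n) (restrictSpace (ε • F) (closure (range φ)))) atTop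
      (𝓝 H)) (s : ℝ) : CauchySeq fun n => φ (s + t n) := by
  obtain ⟨S, hS⟩ := h.exists_tendsto_projection hν hN hC hM hA'
  have hdich := fun n => h.timeShift (t n)
  have hlimd := DichotomyWith.of_tendsto hdich hA' (fun _ _ => hM _) hS
  set g : ℝ → E := fun τ => f τ + ε • F (τ, φ τ) with hg
  have hgc : ∀ n, Continuous fun τ => g (τ + t n) := fun n => by fun_prop
  have hE := fun s => hlimd.tendsto_greenIntegral_sub hν hdich (fun _ _ => hM _) hA' hS hgc
    (fun n τ => hB _) s
  -- Uniformity over the compact set is needed because the translates are evaluated at the moving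
  -- points `φ (τ + t n)`.
  have hunif : ∀ τ η, 0 < η → ∀ᶠ n in atTop, ∀ x : closure (range φ),
      dist (H (τ, x)) (ε • F (τ + t n, (x : E))) < η := fun τ η hη => by
    have := isCompact_iff_compactSpace.1 hQ
    have := Metric.tendstoUniformlyOn_iff.1
      (ContinuousMap.tendsto_iff_forall_isCompact_tendstoUniformlyOn.1 hH ({τ} ×ˢ univ)
        (isCompact_singleton.prod isCompact_univ)) η hη
    filter_upwards [this] with n hn x
    exact hn (τ, x) ⟨rfl, mem_univ _⟩
  have hφb : ∀ τ, ‖φ τ‖ ≤ ‖φ‖ := φ.norm_coe_le_norm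
  -- The bound must hold at every `s` before it can be improved at one, since the Green integral
  -- sees all times; each round gains the factor `1/2` from `hε`.
  have key : ∀ j : ℕ, ∀ s η, 0 < η → ∀ᶠ p : ℕ × ℕ in atTop ×ˢ atTop,
      ‖φ (s + t p.1) - φ (s + t p.2)‖ ≤ 2 * ‖φ‖ * (1 / 2) ^ j + η := by
    intro j
    induction j with
    | zero =>
      refine fun s η hη => Eventually.of_forall fun p => (norm_sub_le _ _).trans ?_
      rw [pow_zero]
      linarith [hφb (s + t p.1), hφb (s + t p.2)]
    | succ j ih =>
      intro s η hη
      set K : ℝ := 2 * ‖φ‖ * (1 / 2) ^ j with hK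
      have hK0 : 0 ≤ K := by positivity
      have hεL : 0 ≤ ‖ε‖ * L := by positivity
      have hw : ∀ τ η, 0 < η → ∀ᶠ p : ℕ × ℕ in atTop ×ˢ atTop,
          ‖g (τ + t p.1) - g (τ + t p.2)‖ ≤ ‖ε‖ * L * K + η := by
        intro τ η hη
        have hη1 : 0 < η / (5 + ‖ε‖ * L) := by positivity
        -- Two errors `δ` come from `f`, two from `ε • F` and `‖ε‖ * L * δ` from the induction
        -- hypothesis; `5` in place of `4` leaves slack.
        set δ := η / (5 + ‖ε‖ * L) with hδ
        have hδη : δ * (5 + ‖ε‖ * L) = η := div_mul_cancel₀ _ (by positivity)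
        have hfe := Metric.tendsto_nhds.1 (tendsto_timeShift_apply hf' τ) δ hη1
        have hHe := hunif τ δ hη1
        filter_upwards [ih τ δ hη1, (hfe.and hHe).prod_mk (hfe.and hHe)]
          with p hp hq
        obtain ⟨⟨hf1, hH1⟩, hf2, hH2⟩ := hq
        have hm : ∀ n, φ (τ + t n) ∈ closure (range φ) := fun n => subset_closure ⟨_, rfl⟩
        have e1 := dist_triangle_right (f (τ + t p.1)) (f (τ + t p.2)) (f' τ)
        have e2 := dist_triangle_left (ε • F (τ + t p.1, φ (τ + t p.1)))
          (ε • F (τ + t p.2, φ (τ + t p.1))) (H (τ, ⟨_, hm p.1⟩))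
        have e3 := hH1 ⟨_, hm p.1⟩
        have e4 := hH2 ⟨_, hm p.1⟩
        have e5 : dist (ε • F (τ + t p.2, φ (τ + t p.1))) (ε • F (τ + t p.2, φ (τ + t p.2))) ≤
            ‖ε‖ * L * (K + δ) := by
          rw [dist_eq_norm, ← smul_sub, norm_smul, mul_assoc]
          exact mul_le_mul_of_nonneg_left ((hLip _ _ _).trans (mul_le_mul_of_nonneg_left hp hL))
            (norm_nonneg _)
        have e6 := dist_triangle (ε • F (τ + t p.1, φ (τ + t p.1)))
          (ε • F (τ + t p.2, φ (τ + t p.1))) (ε • F (τ + t p.2, φ (τ + t p.2)))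
        have e7 := dist_add_add_le (f (τ + t p.1)) (ε • F (τ + t p.1, φ (τ + t p.1)))
          (f (τ + t p.2)) (ε • F (τ + t p.2, φ (τ + t p.2)))
        rw [← dist_eq_norm]
        simp only [hg]
        simp only at e3 e4
        linarith
      have hev := hlimd.eventually_norm_greenIntegral_le hν hN
        (w := fun (p : ℕ × ℕ) τ => g (τ + t p.1) - g (τ + t p.2))
        (fun p => (hgc _).sub (hgc _)) (B := B + B)
        (fun p τ => (norm_sub_le _ _).trans (add_le_add (hB _) (hB _)))
        (mul_nonneg hεL hK0) hw s (η := η / 3) (by positivity)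
      -- The other two thirds of `η` pay for replacing the translated Green's functions at `p.1` and
      -- `p.2` by the limiting one.
      have hE' := Metric.tendsto_nhds.1 (hE s) (η / 3) (by positivity)
      filter_upwards [hev, hE'.prod_mk hE'] with p hp hq
      obtain ⟨hq1, hq2⟩ := hq
      rw [dist_zero_right] at hq1 hq2
      rw [← hlimd.greenIntegral_sub hν (hgc _) (hgc _) (fun τ => hB _) (fun τ => hB _)] at hp
      rw [hφ (s + t p.1), hφ (s + t p.2), greenIntegral_add, greenIntegral_add]
      have hcK : kernelMass N ν * (‖ε‖ * L * K) ≤ 1 / 2 * K := by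
        rw [← mul_assoc]
        exact mul_le_mul_of_nonneg_right hε hK0
      have hKs : 2 * ‖φ‖ * (1 / 2) ^ (j + 1) = 1 / 2 * K := by rw [hK]; ring
      rw [hKs]
      set a₁ := greenIntegral (timeShift (t p.1) A) (conjCauchy A P (t p.1) (t p.1))
        (fun τ => g (τ + t p.1)) s
      set a₂ := greenIntegral (timeShift (t p.2) A) (conjCauchy A P (t p.2) (t p.2))
        (fun τ => g (τ + t p.2)) s
      set b₁ := greenIntegral A' S (fun τ => g (τ + t p.1)) s
      set b₂ := greenIntegral A' S (fun τ => g (τ + t p.2)) s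
      have e : a₁ - a₂ = (a₁ - b₁) + (b₁ - b₂) - (a₂ - b₂) := by abel
      change ‖a₁ - a₂‖ ≤ _
      rw [e]
      linarith [norm_sub_le ((a₁ - b₁) + (b₁ - b₂)) (a₂ - b₂), norm_add_le (a₁ - b₁) (b₁ - b₂)]
  rw [cauchySeq_iff_tendsto_dist_atTop_0, ← prod_atTop_atTop_eq]
  refine Metric.tendsto_nhds.2 fun e he => ?_
  have hpow : Tendsto (fun j : ℕ => 2 * ‖φ‖ * (1 / 2 : ℝ) ^ j) atTop (𝓝 0) := by
    simpa using (tendsto_pow_atTop_nhds_zero_of_lt_one (r := (1 / 2 : ℝ)) (by norm_num)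
      (by norm_num)).const_mul (2 * ‖φ‖)
  obtain ⟨j, hj⟩ := (hpow.eventually (gt_mem_nhds (half_pos he))).exists
  filter_upwards [key j s (e / 2) (half_pos he)] with p hp
  rw [Real.dist_eq, sub_zero, abs_of_nonneg dist_nonneg, dist_eq_norm]
  linarith

end RemoteCompatibility

/-! ### The solution properties, dependence on `ε`, and the theorem. -/

section Main

variable {𝕜 E : Type*} [RCLike 𝕜] [NormedAddCommGroup E] [NormedSpace ℝ E]
  [NormedSpace 𝕜 E] [IsScalarTower ℝ 𝕜 E] [CompleteSpace E]
  {A : C(ℝ, E →L[𝕜] E)} {f : C(ℝ, E)} {F : C(ℝ × E, E)} {P : E →L[𝕜] E} {N ν L : ℝ}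

theorem isRemotelyCompatibleSolution_of_eq_greenIntegral (h : DichotomyWith A P N ν) (hν : 0 < ν)
    (hN : 0 ≤ N) (hC : ConditionC A P) (hA : LagrangeStable A) (hL : 0 ≤ L)
    (hLip : ∀ t x y, ‖F (t, x) - F (t, y)‖ ≤ L * ‖x - y‖) {ε : 𝕜}
    (hε : kernelMass N ν * (‖ε‖ * L) ≤ 1 / 2) {φ : ℝ →ᵇ E}
    (hφ : ∀ t, φ t = greenIntegral A P (fun τ => f τ + ε • F (τ, φ τ)) t)
    (hQ : IsCompact (closure (range φ))) {B : ℝ} (hB : ∀ τ, ‖f τ + ε • F (τ, φ τ)‖ ≤ B) :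
    IsRemotelyCompatibleSolution A f (ε • F) φ.toContinuousMap := by
  obtain ⟨M, hM⟩ := exists_norm_le_of_lagrangeStable hA
  have hsol : ∀ t, HasDerivAt φ (A t (φ t) + (f t + ε • F (t, φ t))) t := fun t => by
    have := h.hasDerivAt_greenIntegral hν
      (g := fun τ => f τ + ε • F (τ, φ τ)) (by fun_prop) hB t
    rwa [← hφ t, ← funext hφ] at this
  -- The equation itself bounds the derivative, because `A`, `φ` and the forcing term are bounded.
  have hlip : LipschitzWith (M * ‖φ‖ + B).toNNReal φ := by
    refine lipschitzWith_of_nnnorm_deriv_le (𝕜 := ℝ) (fun t => (hsol t).differentiableAt)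
      fun t => ?_
    rw [(hsol t).deriv, ← NNReal.coe_le_coe, coe_nnnorm]
    refine le_trans ?_ (Real.le_coe_toNNReal _)
    exact (norm_add_le _ _).trans (add_le_add
      (ContinuousLinearMap.le_of_opNorm_le_of_le _ (hM t) (φ.norm_coe_le_norm t)) (hB t))
  refine ⟨fun t => ?_, hQ, ?_⟩
  · have := hsol t
    rwa [← add_assoc] at this
  · rintro t ⟨⟨⟨ht, A', hA'⟩, -, f', hf'⟩, -, H, hH⟩
    exact ⟨ht, exists_tendsto_timeShift_of_lipschitzWith hlip
      (cauchySeq_of_eq_greenIntegral h hν hN hC hM hL hLip hε hφ hQ hB hA' hf' hH)⟩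

/-- Subtracting the two integral equations gives `d ≤ c ‖ε‖ (L d + C)` for the distance `d`; by `hε`
the term in `d` on the right is at most `d / 2` and is absorbed. -/
theorem dist_le_of_eq_greenIntegral (h : DichotomyWith A P N ν) (hν : 0 < ν)
    (hN : 0 ≤ N) (hf : LagrangeStable f) (hF : LagrangeStable₂ F) (hL : 0 ≤ L)
    (hLip : ∀ t x y, ‖F (t, x) - F (t, y)‖ ≤ L * ‖x - y‖) {ε : 𝕜}
    (hε : kernelMass N ν * (‖ε‖ * L) ≤ 1 / 2) {φ φ₀ : ℝ →ᵇ E}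
    (hφ : ∀ t, φ t = greenIntegral A P (fun τ => f τ + ε • F (τ, φ τ)) t)
    (hφ₀ : ∀ t, φ₀ t = greenIntegral A P f t) {C : ℝ} (hC : ∀ τ, ‖F (τ, φ₀ τ)‖ ≤ C) :
    dist φ φ₀ ≤ 2 * kernelMass N ν * C * ‖ε‖ := by
  have hc := kernelMass_nonneg hN ν
  have hC0 : 0 ≤ C := (norm_nonneg _).trans (hC 0)
  obtain ⟨B, hB⟩ := exists_norm_forcing_le hf hF hL hLip ε φ
  obtain ⟨B', hB'⟩ := exists_norm_le_of_lagrangeStable hf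
  have key : dist φ φ₀ ≤ kernelMass N ν * (‖ε‖ * (L * dist φ φ₀ + C)) := by
    refine (BoundedContinuousFunction.dist_le (by positivity)).2 fun t => ?_
    rw [hφ, hφ₀, dist_eq_norm, h.greenIntegral_sub hν (by fun_prop) f.continuous hB hB']
    refine h.norm_greenIntegral_le hν (fun τ => ?_) t
    rw [add_sub_cancel_left, norm_smul]
    refine mul_le_mul_of_nonneg_left ?_ (norm_nonneg _)
    have h1 := norm_add_le (F (τ, φ τ) - F (τ, φ₀ τ)) (F (τ, φ₀ τ))
    rw [sub_add_cancel] at h1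
    have h2 := mul_le_mul_of_nonneg_left (BoundedContinuousFunction.dist_coe_le_dist
      (f := φ) (g := φ₀) τ) hL
    rw [dist_eq_norm] at h2
    linarith [hLip τ (φ τ) (φ₀ τ), hC τ]
  have h3 := mul_le_mul_of_nonneg_right hε (dist_nonneg (x := φ) (y := φ₀))
  linarith

end Main

theorem theorem6p5 {𝕜 E : Type*} [RCLike 𝕜] [NormedAddCommGroup E] [NormedSpace ℝ E]
    [NormedSpace 𝕜 E] [IsScalarTower ℝ 𝕜 E] [CompleteSpace E]
    (A : C(ℝ, E →L[𝕜] E)) (f : C(ℝ, E)) (F : C(ℝ × E, E)) (P : E →L[𝕜] E)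
    (hyp : HasExpDichotomy A univ P) (hC : ConditionC A P)
    (hA : LagrangeStable A) (hf : LagrangeStable f) (hF : LagrangeStable₂ F)
    (L : ℝ) (hL : 0 < L) (hLip : ∀ t x y, ‖F (t, x) - F (t, y)‖ ≤ L * ‖x - y‖) :
    ∃ ε₀ : ℝ, 0 < ε₀ ∧ ∃ φ : 𝕜 → (ℝ →ᵇ E),
      (∀ ε : 𝕜, ‖ε‖ ≤ ε₀ →
        IsRemotelyCompatibleSolution A f (ε • F) (φ ε).toContinuousMap ∧
        IsGreenIntegral A P (fun τ => f τ + ε • F (τ, φ ε τ)) (φ ε)) ∧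
      (IsRemotelyCompatibleSolution A f 0 (φ 0).toContinuousMap ∧
        IsGreenIntegral A P f (φ 0)) ∧
      TendstoUniformly (fun ε t => φ ε t) (φ 0) (𝓝 0) := by
  obtain ⟨hP, N, ν, hN1, hν, hs, hu⟩ := hyp
  have hN : 0 ≤ N := zero_le_one.trans hN1
  have h : DichotomyWith A P N ν :=
    ⟨hP, fun t τ => hs t trivial τ trivial, fun t τ => hu t trivial τ trivial⟩
  have hc := kernelMass_nonneg hN ν
  set c := kernelMass N ν
  -- This threshold gives `c ‖ε‖ L ≤ 1/2`; with `c + 1` in place of `c`, nonnegativity of the kernel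
  -- mass suffices.
  have hε₀ : 0 < 1 / (2 * L * (c + 1)) := by positivity
  have hsmall : ∀ ε : 𝕜, ‖ε‖ ≤ 1 / (2 * L * (c + 1)) → c * (‖ε‖ * L) ≤ 1 / 2 := fun ε hε => by
    rw [le_div_iff₀ (by positivity)] at hε
    have := mul_nonneg (norm_nonneg ε) hL.le
    linarith
  have hex := fun (ε : 𝕜) hε =>
    exists_eq_greenIntegral h hν hN hC hA hf hF hL.le hLip (hsmall ε hε)
  -- Outside the ball of radius `ε₀` the values of `φ` are arbitrary, which does not affect the
  -- limit at `0`.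
  choose! φ hφ hQ using hex
  have hmain : ∀ ε : 𝕜, ‖ε‖ ≤ 1 / (2 * L * (c + 1)) →
      IsRemotelyCompatibleSolution A f (ε • F) (φ ε).toContinuousMap ∧
      IsGreenIntegral A P (fun τ => f τ + ε • F (τ, φ ε τ)) (φ ε) := fun ε hε => by
    obtain ⟨B, hB⟩ := exists_norm_forcing_le hf hF hL.le hLip ε (φ ε)
    exact ⟨isRemotelyCompatibleSolution_of_eq_greenIntegral h hν hN hC hA hL.le hLip
      (hsmall ε hε) (hφ ε hε) (hQ ε hε) hB, fun t =>
      ⟨h.integrable_greenFunction hν (by fun_prop) hB t, hφ ε hε t⟩⟩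
  have h0 : ‖(0 : 𝕜)‖ ≤ 1 / (2 * L * (c + 1)) := by simpa using hε₀.le
  refine ⟨_, hε₀, φ, hmain, by simpa using hmain 0 h0, ?_⟩
  have hφ₀ : ∀ t, φ 0 t = greenIntegral A P f t := by simpa using hφ 0 h0
  obtain ⟨C, hC⟩ := exists_norm_comp_le hF hL.le hLip (φ 0)
  refine BoundedContinuousFunction.tendsto_iff_tendstoUniformly.1
    (tendsto_iff_dist_tendsto_zero.2 ?_)
  have hlim : Tendsto (fun ε : 𝕜 => 2 * c * C * ‖ε‖) (𝓝 0) (𝓝 0) := by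
    simpa using (tendsto_norm_zero (E := 𝕜)).const_mul (2 * c * C)
  refine squeeze_zero' (Eventually.of_forall fun _ => dist_nonneg) ?_ hlim
  filter_upwards [tendsto_norm_zero.eventually (gt_mem_nhds hε₀)] with ε hε
  exact dist_le_of_eq_greenIntegral h hν hN hf hF hL.le hLip (hsmall ε hε.le) (hφ ε hε.le) hφ₀ hC
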